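/- **Setting.** Let $A=(A_1,\dots,A_n)$ be $n\ge 1$ points in $\mathbb{R}^d$ with the Euclidean norm (repetitions allowed), let $c:[n]\to[\ell]$ be a coloring, and let $k\ge 1$ be an integer. A set $S\subseteq[n]$ is *balanced* if every color in $[\ell]$ occurs equally often in $S$. A *fair $k$-clustering* is an $n\times d$ matrix $C$ with at most $k$ distinct rows (the row $C_i$ is the center to which $A_i$ is assigned) such that for every $j$ the cluster $\{i : C_i=C_j\}$ is balanced. Its cost is $\sum_i\|A_i-C_i\|_2$ for fair $k$-median, $\sum_i\|A_i-C_i\|_2^2$ for fair $k$-means, and $\max_i\|A_i-C_i\|_2$ for fair $k$-center. Algorithms are programs for a real RAM: a machine with integer and real memory cells and indirect addressing, in which memory accesses, assignments, comparisons, the operations $+,-,\times$ on integers and $+,-,\times,/,\sqrt{\cdot}$ on reals, and the conversion of an integer to a real each take one step. **Theorem (PTAS for constant $k$).** For each of the three objectives (fair $k$-median, fair $k$-means, fair $k$-center) there are a program, a polynomial $p$ and a constant $K$ such that for all $k\ge 1$, $\varepsilon>0$, $n\ge1$, $d$, $\ell$, all $A$ and all $c$, the program on input $(A,c,k,\varepsilon)$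 halts after at most $$K\cdot(d+1)\cdot n^{\,p(k/\min\{\varepsilon,1\})}$$ steps with an output matrix $C$ of the following kind: if a fair $k$-clustering of $(A,c)$ exists, then $C$ is a fair $k$-clustering, and its cost is at most $(1+\varepsilon)$ times the cost of every fair $k$-clustering of $(A,c)$. In particular, for $0<\varepsilon\le 1$ the running time is $O\big(d\cdot n^{\mathrm{poly}(k/\varepsilon)}\big)$ (for $d \ge 1$). -/

import Mathlib

namespace FairClustering

/-! ### Fair clustering in Euclidean space -/

/-- A set `S` of (indices of) points is balanced if all colours occur equally often in it. -/
def Balanced {n ℓ : ℕ} (c : Fin n → Fin ℓ) (S : Finset (Fin n)) : Prop :=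
  ∀ a b : Fin ℓ, (S.filter fun i => c i = a).card = (S.filter fun i => c i = b).card

open Classical in
/-- A fair `k`-clustering, given as an `n × d` matrix `C` whose `i`-th row is the center to which
the `i`-th point is assigned: `C` has at most `k` distinct rows, and for every row the cluster of
all points assigned to it is balanced. -/
def IsFairClustering {n d ℓ : ℕ} (k : ℕ) (c : Fin n → Fin ℓ)
    (C : Fin n → EuclideanSpace ℝ (Fin d)) : Prop :=
  (Finset.univ.image C).card ≤ k ∧
    ∀ j : Fin n, Balanced c (Finset.univ.filter fun i => C i = C j)

/-- The three clustering objectives. -/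
inductive Objective
  | kMedian
  | kMeans
  | kCenter

/-- The cost of assigning the `i`-th point `A i` to the center `C i`, for all `i`: the sum of the
distances, the sum of the squared distances, and the largest distance, respectively. -/
noncomputable def Objective.cost {n d : ℕ} (obj : Objective)
    (A C : Fin n → EuclideanSpace ℝ (Fin d)) : ℝ :=
  match obj with
  | .kMedian => ∑ i, ‖A i - C i‖
  | .kMeans => ∑ i, ‖A i - C i‖ ^ 2
  | .kCenter => ⨆ i, ‖A i - C i‖

/-! ### A real RAM with step count

The memory consists of integer arrays and real arrays, which are numbered and unbounded.  A program
names arrays by fixed numbers and addresses cells by computed integers (indirect addressing).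
Every memory access, constant, arithmetic operation, comparison, Boolean operation and assignment
takes one step.  There are no real constants other than integers, and no rounding operation from
reals to integers. -/

/-- Memory contents: the cell with index `i` of the array with number `a` is `nat a i`
respectively `real a i`. -/
structure Memory where
  nat : ℕ → ℕ → ℕ
  real : ℕ → ℕ → ℝ

/-- Integer expressions. Subtraction is truncated at `0`. -/
inductive NatExpr
  | const (m : ℕ)
  | get (a : ℕ) (i : NatExpr)
  | add (e f : NatExpr)
  | sub (e f : NatExpr)
  | mul (e f : NatExpr)

/-- Real expressions. Division by zero and roots of negative numbers return `0`. -/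
inductive RealExpr
  | cast (e : NatExpr)
  | get (a : ℕ) (i : NatExpr)
  | add (e f : RealExpr)
  | sub (e f : RealExpr)
  | mul (e f : RealExpr)
  | div (e f : RealExpr)
  | sqrt (e : RealExpr)

/-- Boolean expressions. -/
inductive BoolExpr
  | natLT (e f : NatExpr)
  | realLT (e f : RealExpr)
  | not (b : BoolExpr)
  | and (b b' : BoolExpr)

/-- Programs. -/
inductive Program
  | skip
  | setNat (a : ℕ) (i e : NatExpr)
  | setReal (a : ℕ) (i : NatExpr) (e : RealExpr)
  | seq (P Q : Program)
  | ite (b : BoolExpr) (P Q : Program)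
  | while (b : BoolExpr) (P : Program)

def NatExpr.eval (s : Memory) : NatExpr → ℕ
  | .const m => m
  | .get a i => s.nat a (i.eval s)
  | .add e f => e.eval s + f.eval s
  | .sub e f => e.eval s - f.eval s
  | .mul e f => e.eval s * f.eval s

noncomputable def RealExpr.eval (s : Memory) : RealExpr → ℝ
  | .cast e => (e.eval s : ℝ)
  | .get a i => s.real a (i.eval s)
  | .add e f => e.eval s + f.eval s
  | .sub e f => e.eval s - f.eval s
  | .mul e f => e.eval s * f.eval s
  | .div e f => e.eval s / f.eval s
  | .sqrt e => Real.sqrt (e.eval s)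

def BoolExpr.Holds (s : Memory) : BoolExpr → Prop
  | .natLT e f => e.eval s < f.eval s
  | .realLT e f => e.eval s < f.eval s
  | .not b => ¬ b.Holds s
  | .and b b' => b.Holds s ∧ b'.Holds s

/-- Number of steps needed to evaluate an integer expression. -/
def NatExpr.steps : NatExpr → ℕ
  | .const _ => 1
  | .get _ i => i.steps + 1
  | .add e f => e.steps + f.steps + 1
  | .sub e f => e.steps + f.steps + 1
  | .mul e f => e.steps + f.steps + 1

/-- Number of steps needed to evaluate a real expression. -/
def RealExpr.steps : RealExpr → ℕ
  | .cast e => e.steps + 1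
  | .get _ i => i.steps + 1
  | .add e f => e.steps + f.steps + 1
  | .sub e f => e.steps + f.steps + 1
  | .mul e f => e.steps + f.steps + 1
  | .div e f => e.steps + f.steps + 1
  | .sqrt e => e.steps + 1

/-- Number of steps needed to evaluate a Boolean expression. -/
def BoolExpr.steps : BoolExpr → ℕ
  | .natLT e f => e.steps + f.steps + 1
  | .realLT e f => e.steps + f.steps + 1
  | .not b => b.steps + 1
  | .and b b' => b.steps + b'.steps + 1

def Memory.setNat (s : Memory) (a i v : ℕ) : Memory :=
  { s with nat := Function.update s.nat a (Function.update (s.nat a) i v) }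

noncomputable def Memory.setReal (s : Memory) (a i : ℕ) (v : ℝ) : Memory :=
  { s with real := Function.update s.real a (Function.update (s.real a) i v) }

/-- `Exec P s s' t`: started with memory `s`, the program `P` halts after exactly `t` steps with
memory `s'`. -/
inductive Exec : Program → Memory → Memory → ℕ → Prop
  | skip (s : Memory) : Exec .skip s s 1
  | setNat (s : Memory) (a : ℕ) (i e : NatExpr) :
      Exec (.setNat a i e) s (s.setNat a (i.eval s) (e.eval s)) (i.steps + e.steps + 1)
  | setReal (s : Memory) (a : ℕ) (i : NatExpr) (e : RealExpr) :
      Exec (.setReal a i e) s (s.setReal a (i.eval s) (e.eval s)) (i.steps + e.steps + 1)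
  | seq {P Q : Program} {s s' s'' : Memory} {t t' : ℕ} (hP : Exec P s s' t)
      (hQ : Exec Q s' s'' t') : Exec (.seq P Q) s s'' (t + t')
  | iteTrue {b : BoolExpr} {P Q : Program} {s s' : Memory} {t : ℕ} (hb : b.Holds s)
      (hP : Exec P s s' t) : Exec (.ite b P Q) s s' (b.steps + 1 + t)
  | iteFalse {b : BoolExpr} {P Q : Program} {s s' : Memory} {t : ℕ} (hb : ¬ b.Holds s)
      (hQ : Exec Q s s' t) : Exec (.ite b P Q) s s' (b.steps + 1 + t)
  | whileFalse {b : BoolExpr} {P : Program} {s : Memory} (hb : ¬ b.Holds s) :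
      Exec (.while b P) s s (b.steps + 1)
  | whileTrue {b : BoolExpr} {P : Program} {s s' s'' : Memory} {t t' : ℕ} (hb : b.Holds s)
      (hP : Exec P s s' t) (hW : Exec (.while b P) s' s'' t') :
      Exec (.while b P) s s'' (b.steps + 1 + t + t')

/-! ### Input and output -/

/-- The initial memory. Integer array `0` holds `n, d, ℓ, k`, integer array `1` holds the colours of
the points, real array `0` holds `ε`, and real array `1` holds the coordinates of the points, row by
row: coordinate `j` of point `i` has index `i * d + j`. All other cells are `0`. -/
noncomputable def inputMemory {n d ℓ : ℕ} (A : Fin n → EuclideanSpace ℝ (Fin d))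
    (c : Fin n → Fin ℓ) (k : ℕ) (ε : ℝ) : Memory where
  nat
    | 0, 0 => n
    | 0, 1 => d
    | 0, 2 => ℓ
    | 0, 3 => k
    | 1, i => if h : i < n then (c ⟨i, h⟩ : ℕ) else 0
    | _, _ => 0
  real
    | 0, 0 => ε
    | 1, m =>
        if h : m / d < n ∧ m % d < d then A ⟨m / d, h.1⟩ ⟨m % d, h.2⟩ else 0
    | _, _ => 0

/-- The output matrix: coordinate `j` of the center of point `i` is read from the cell with index
`i * d + j` of real array `2`. -/
noncomputable def outputMatrix (n d : ℕ) (s : Memory) : Fin n → EuclideanSpace ℝ (Fin d) :=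
  fun i => WithLp.toLp 2 fun j => s.real 2 (i * d + j)

end FairClustering

/-!
In a fair clustering with centers `j < k`, all colour classes use every center equally often. Encode
the numbers of uses by a colour class as the digits of a number in base `n + 1`: an assignment of
the points to the centers is fair if all colour classes have the same code.

The centers of an optimal solution can be replaced by means of `⌈1 / ε ^ 2⌉` input points
(repetitions allowed) at the expense of a factor `1 + ε`. This is a variance computation, in which
averaging over all samples takes the place of randomness: for `k`-means after moving the center to
the mean of its cluster, for `k`-median after one Weiszfeld step, which moves the center to a
weighted mean without increasing the cost, and for `k`-center after projecting the center to the
convex hull of its cluster.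

So there are `n ^ (k * ⌈1 / ε ^ 2⌉) * (n + 1) ^ k` guesses for the sampled points and the common
code. For each guess, a dynamic program finds a cheapest assignment with the guessed code for every
colour class. A program whose loops take at most `Y` rounds, or at most `D` rounds if they run
through the coordinates, runs for `O((D + 1) ^ i * Y ^ j)` steps, where `i` and `j` are the nesting
depths of the two kinds of loops; here `i = 1` and `j = 4`.
-/

namespace FairClustering

/-! ### Accumulated costs -/

/-- The operation that combines the costs of single points: the maximum for `k`-center, and
addition otherwise. -/
noncomputable def Objective.op (obj : Objective) (x y : ℝ) : ℝ :=
  match obj with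
  | .kCenter => max x y
  | _ => x + y

/-- The combined cost of the points `0, …, n - 1` with costs `f 0, …, f (n - 1)`, accumulated in
the order in which a program does it. -/
noncomputable def Objective.total (obj : Objective) (f : ℕ → ℝ) : ℕ → ℝ
  | 0 => 0
  | n + 1 => obj.op (obj.total f n) (f n)

namespace Objective

variable {f g : ℕ → ℝ} {n : ℕ}

theorem op_mono (obj : Objective) {x x' : ℝ} (h : x ≤ x') (y : ℝ) : obj.op x y ≤ obj.op x' y := by
  cases obj
  · exact add_le_add_left h y
  · exact add_le_add_left h y
  · exact max_le_max_right y h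

theorem op_nonneg (obj : Objective) {x y : ℝ} (hx : 0 ≤ x) (hy : 0 ≤ y) : 0 ≤ obj.op x y := by
  cases obj
  · exact add_nonneg hx hy
  · exact add_nonneg hx hy
  · exact le_max_of_le_left hx

theorem op_zero (obj : Objective) {x : ℝ} (hx : 0 ≤ x) : obj.op x 0 = x := by
  cases obj
  · exact add_zero x
  · exact add_zero x
  · exact max_eq_left hx

theorem total_nonneg (obj : Objective) (hf : ∀ i < n, 0 ≤ f i) : 0 ≤ obj.total f n := by
  induction n with
  | zero => exact le_rfl
  | succ n ih =>
    rw [Nat.forall_lt_succ_right] at hf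
    exact obj.op_nonneg (ih hf.1) hf.2

theorem total_congr (obj : Objective) (h : ∀ i < n, f i = g i) : obj.total f n = obj.total g n := by
  induction n with
  | zero => rfl
  | succ n ih =>
    rw [Nat.forall_lt_succ_right] at h
    rw [total, total, ih h.1, h.2]

theorem total_eq_sum {obj : Objective} (h : obj ≠ .kCenter) (f : ℕ → ℝ) (n : ℕ) :
    obj.total f n = ∑ i ∈ Finset.range n, f i := by
  induction n with
  | zero => rfl
  | succ n ih =>
    rw [Finset.sum_range_succ, ← ih]
    cases obj
    · rfl
    · rfl
    · exact absurd rfl h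

theorem total_kCenter_le_iff {x : ℝ} (hx : 0 ≤ x) :
    kCenter.total f n ≤ x ↔ ∀ i < n, f i ≤ x := by
  induction n with
  | zero => simp [total, hx]
  | succ n ih => rw [total, op, max_le_iff, ih, Nat.forall_lt_succ_right]

theorem total_le_total_of_classes (obj : Objective) {ℓ : ℕ} {color : ℕ → ℕ}
    (hcolor : ∀ i < n, color i < ℓ) (hg : ∀ i < n, 0 ≤ g i)
    (h : ∀ a < ℓ, obj.total (fun i => if color i = a then f i else 0) n ≤
      obj.total (fun i => if color i = a then g i else 0) n) :
    obj.total f n ≤ obj.total g n := by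
  by_cases hobj : obj = .kCenter
  · subst hobj
    have hg₀ := kCenter.total_nonneg hg
    have hclass (a : ℕ) : kCenter.total (fun i => if color i = a then g i else 0) n ≤
        kCenter.total g n := by
      refine (total_kCenter_le_iff hg₀).2 fun i hi => ?_
      split_ifs
      · exact (total_kCenter_le_iff hg₀).1 le_rfl i hi
      · exact hg₀
    refine (total_kCenter_le_iff hg₀).2 fun i hi => ?_
    simpa only [if_true] using
      (total_kCenter_le_iff hg₀).1 ((h _ (hcolor i hi)).trans (hclass _)) i hi
  · have sum_classes (u : ℕ → ℝ) : ∑ a ∈ Finset.range ℓ, ∑ i ∈ Finset.range n,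
        (if color i = a then u i else 0) = ∑ i ∈ Finset.range n, u i := by
      rw [Finset.sum_comm]
      refine Finset.sum_congr rfl fun i hi => ?_
      rw [Finset.sum_ite_eq, if_pos]
      exact Finset.mem_range.2 (hcolor i (Finset.mem_range.1 hi))
    simp only [total_eq_sum hobj] at h ⊢
    rw [← sum_classes f, ← sum_classes g]
    exact Finset.sum_le_sum fun a ha => h a (Finset.mem_range.1 ha)

end Objective

/-! ### The dynamic program for one colour class -/

/-- The code of an assignment `τ` of the points below `n` of colour `a` to centers: the sum of the
digits of the centers, over all these points. -/
def classCode (color digit : ℕ → ℕ) (a : ℕ) (τ : ℕ → ℕ) (n : ℕ) : ℕ :=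
  ∑ i ∈ Finset.range n with color i = a, digit (τ i)

theorem classCode_succ (color digit : ℕ → ℕ) (a : ℕ) (τ : ℕ → ℕ) (n : ℕ) :
    classCode color digit a τ (n + 1) =
      classCode color digit a τ n + if color n = a then digit (τ n) else 0 := by
  simp only [classCode, Finset.sum_filter, Finset.sum_range_succ]

/-- The problem solved by the dynamic program: the points `i < n` with `color i = cls` are to be
assigned to centers below `k`, where assigning `i` to `j` costs `weight i j`, such that the
assignment has a prescribed code below `numCodes`. -/
structure ClassProblem where
  obj : Objective
  n : ℕ
  k : ℕ
  numCodes : ℕ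
  color : ℕ → ℕ
  cls : ℕ
  digit : ℕ → ℕ
  weight : ℕ → ℕ → ℝ

theorem cell_lt {n R i r : ℕ} (hi : i < n) (hr : r < R) : i * R + r < n * R :=
  calc i * R + r < i * R + R := Nat.add_lt_add_left hr _
    _ = (i + 1) * R := (Nat.succ_mul i R).symm
    _ ≤ n * R := Nat.mul_le_mul_right R hi

theorem cell_div {R i r : ℕ} (hr : r < R) : (i * R + r) / R = i :=
  Nat.div_eq_of_lt_le (Nat.le_add_right _ _) (cell_lt (Nat.lt_succ_self i) hr)

namespace ClassProblem

/-- The code of the assignment `τ` of the points below `i` of the class. -/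
def code (D : ClassProblem) (τ : ℕ → ℕ) (i : ℕ) : ℕ :=
  classCode D.color D.digit D.cls τ i

/-- The cost of the assignment `τ` of the points below `i` of the class. -/
noncomputable def cost (D : ClassProblem) (τ : ℕ → ℕ) (i : ℕ) : ℝ :=
  D.obj.total (fun i => if D.color i = D.cls then D.weight i (τ i) else 0) i

/-- In the table `T`, the point of the cell `x` may be assigned to the center `j`. -/
def Usable (D : ClassProblem) (T : ℕ → ℝ) (x j : ℕ) : Prop :=
  D.digit j ≤ x % D.numCodes ∧ 0 ≤ T (x - D.digit j)

/-- The cost of an assignment that extends the one of the cell `x - digit j` by assigning the point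
of the cell `x` to the center `j`. -/
noncomputable def candidate (D : ClassProblem) (T : ℕ → ℝ) (x j : ℕ) : ℝ :=
  D.obj.op (T (x - D.digit j)) (D.weight (x / D.numCodes) j)

/-- The cell `i * numCodes + r` of the table `T` stands for the assignments with code `r` of the
points below `i`, and a negative entry for infeasibility. `CellCorrect` says that the cell
`x + numCodes`, in which the point `x / numCodes` is assigned last, is filled by minimizing over the
centers below `m`, and that `back x` is a minimizer. -/
def CellCorrect (D : ClassProblem) (T : ℕ → ℝ) (back : ℕ → ℕ) (m x : ℕ) : Prop :=
  (T (x + D.numCodes) < 0 ∧ ∀ j < m, ¬ D.Usable T x j) ∨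
  (0 ≤ T (x + D.numCodes) ∧ back x < m ∧ D.Usable T x (back x) ∧
    T (x + D.numCodes) = D.candidate T x (back x) ∧
    ∀ j < m, D.Usable T x j → T (x + D.numCodes) ≤ D.candidate T x j)

/-- The cells below `N + numCodes` of the table `T` are filled correctly, with minimizers `back`. -/
structure TableCorrect (D : ClassProblem) (N : ℕ) (T : ℕ → ℝ) (back : ℕ → ℕ) : Prop where
  zero : T 0 = 0
  neg : ∀ r, 0 < r → r < D.numCodes → T r < 0
  skip : ∀ x < N, D.color (x / D.numCodes) ≠ D.cls → T (x + D.numCodes) = T x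
  step : ∀ x < N, D.color (x / D.numCodes) = D.cls → D.CellCorrect T back D.k x

/-- The assignment `σ` solves the problem for the code `r`. -/
structure IsOptimal (D : ClassProblem) (r : ℕ) (σ : ℕ → ℕ) : Prop where
  center_lt : ∀ i < D.n, D.color i = D.cls → σ i < D.k
  code_eq : D.code σ D.n = r
  cost_le : ∀ τ : ℕ → ℕ, (∀ i < D.n, τ i < D.k) → D.code τ D.n = r → D.cost σ D.n ≤ D.cost τ D.n

/-- Invariant of the reconstruction of an optimal assignment `σ` with code `r` from the table `T`:
the points of the class from `i` on are assigned, and it remains to assign the points below `i`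
with code `rc`. -/
structure Traced (D : ClassProblem) (T : ℕ → ℝ) (r i rc : ℕ) (σ : ℕ → ℕ) : Prop where
  lt : rc < D.numCodes
  nonneg : 0 ≤ T (i * D.numCodes + rc)
  center_lt : ∀ i' < D.n, i ≤ i' → D.color i' = D.cls → σ i' < D.k
  extend : ∀ τ : ℕ → ℕ, (∀ i' < D.n, i ≤ i' → D.color i' = D.cls → τ i' = σ i') →
    D.code τ i = rc → D.cost τ i = T (i * D.numCodes + rc) →
    D.code τ D.n = r ∧ D.cost τ D.n = T (D.n * D.numCodes + r)

variable {D : ClassProblem} {T T' : ℕ → ℝ} {back back' : ℕ → ℕ} {N i j r rc x : ℕ} {σ τ : ℕ → ℕ}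

theorem code_succ_of_eq (hi : D.color i = D.cls) :
    D.code τ (i + 1) = D.code τ i + D.digit (τ i) := by
  rw [code, classCode_succ, if_pos hi, code]

theorem code_succ_of_ne (hi : D.color i ≠ D.cls) : D.code τ (i + 1) = D.code τ i := by
  rw [code, classCode_succ, if_neg hi, code, add_zero]

theorem cost_succ_of_eq (hi : D.color i = D.cls) :
    D.cost τ (i + 1) = D.obj.op (D.cost τ i) (D.weight i (τ i)) := by
  rw [cost, Objective.total, if_pos hi, cost]

theorem cost_succ_of_ne (hi : D.color i ≠ D.cls) (h : 0 ≤ D.cost τ i) :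
    D.cost τ (i + 1) = D.cost τ i := by
  rw [cost, Objective.total, if_neg hi]
  exact D.obj.op_zero h

theorem IsOptimal.congr (h : D.IsOptimal r σ)
    (hτ : ∀ i < D.n, D.color i = D.cls → τ i = σ i) : D.IsOptimal r τ where
  center_lt i hi hcls := hτ i hi hcls ▸ h.center_lt i hi hcls
  code_eq := by
    rw [← h.code_eq, code, code, classCode, classCode]
    refine Finset.sum_congr rfl fun i hi => ?_
    rw [Finset.mem_filter, Finset.mem_range] at hi
    rw [hτ i hi.1 hi.2]
  cost_le τ' hτ' hcode := by
    refine (D.obj.total_congr fun i hi => ?_).trans_le (h.cost_le τ' hτ' hcode)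
    split_ifs with hcls
    · rw [hτ i hi hcls]
    · rfl

theorem CellCorrect.keep (h : D.CellCorrect T back j x)
    (hj : ¬ (D.Usable T x j ∧
      (T (x + D.numCodes) < 0 ∨ D.candidate T x j < T (x + D.numCodes)))) :
    D.CellCorrect T back (j + 1) x := by
  rcases h with ⟨hneg, hnone⟩ | ⟨hnonneg, hlt, husable, heq, hmin⟩
  · exact .inl ⟨hneg, Nat.forall_lt_succ_right.2 ⟨hnone, fun hu => hj ⟨hu, .inl hneg⟩⟩⟩
  · exact .inr ⟨hnonneg, hlt.trans (Nat.lt_succ_self j), husable, heq, Nat.forall_lt_succ_right.2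
      ⟨hmin, fun hu => not_lt.1 fun h => hj ⟨hu, .inr h⟩⟩⟩

theorem CellCorrect.congr (h : D.CellCorrect T back j x)
    (hT : ∀ y ≤ x + D.numCodes, T' y = T y) (hback : back' x = back x) :
    D.CellCorrect T' back' j x := by
  have hdigit (j : ℕ) : T' (x - D.digit j) = T (x - D.digit j) := hT _ (by omega)
  simpa only [CellCorrect, Usable, candidate, hdigit, hT _ le_rfl, hback] using h

theorem CellCorrect.update (h : D.CellCorrect T back j x) (hR : 0 < D.numCodes)
    (hw : 0 ≤ D.weight (x / D.numCodes) j) (hu : D.Usable T x j)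
    (hlt : T (x + D.numCodes) < 0 ∨ D.candidate T x j < T (x + D.numCodes))
    (hT : ∀ y, y ≠ x + D.numCodes → T' y = T y)
    (hT' : T' (x + D.numCodes) = D.candidate T x j) (hback : back' x = j) :
    D.CellCorrect T' back' (j + 1) x := by
  have hdigit (j' : ℕ) : T' (x - D.digit j') = T (x - D.digit j') := hT _ (by omega)
  have hmin : ∀ j' < j, D.Usable T x j' → D.candidate T x j ≤ D.candidate T x j' := by
    rcases h with ⟨-, hnone⟩ | ⟨hnonneg, -, -, -, hmin⟩
    · exact fun j' hj' hu' => absurd hu' (hnone j' hj')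
    · exact fun j' hj' hu' => (hlt.resolve_left hnonneg.not_gt).le.trans (hmin j' hj' hu')
  simp only [CellCorrect, Usable, candidate, hdigit, hT', hback]
  exact .inr ⟨D.obj.op_nonneg hu.2 hw, Nat.lt_succ_self j, hu, trivial,
    Nat.forall_lt_succ_right.2 ⟨hmin, fun _ => le_rfl⟩⟩

theorem TableCorrect.succ (h : D.TableCorrect N T back) (hR : 0 < D.numCodes)
    (hT : ∀ y < N + D.numCodes, T' y = T y) (hback : ∀ y < N, back' y = back y)
    (hskip : D.color (N / D.numCodes) ≠ D.cls → T' (N + D.numCodes) = T' N)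
    (hstep : D.color (N / D.numCodes) = D.cls → D.CellCorrect T' back' D.k N) :
    D.TableCorrect (N + 1) T' back' where
  zero := by rw [hT 0 (by omega), h.zero]
  neg r h₀ hr := by rw [hT r (by omega)]; exact h.neg r h₀ hr
  skip := by
    refine Nat.forall_lt_succ_right.2 ⟨fun x hx hcls => ?_, hskip⟩
    rw [hT _ (by omega), hT _ (by omega), h.skip x hx hcls]
  step := Nat.forall_lt_succ_right.2 ⟨fun x hx hcls =>
    (h.step x hx hcls).congr (fun y hy => hT y (by omega)) (hback x hx), hstep⟩

theorem TableCorrect.eq_of_ne (h : D.TableCorrect (D.n * D.numCodes) T back) (hi : i < D.n)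
    (hr : r < D.numCodes) (hcls : D.color i ≠ D.cls) :
    T ((i + 1) * D.numCodes + r) = T (i * D.numCodes + r) := by
  rw [← h.skip _ (cell_lt hi hr) (by rwa [cell_div hr]), Nat.succ_mul, Nat.add_right_comm]

theorem TableCorrect.cellCorrect (h : D.TableCorrect (D.n * D.numCodes) T back) (hi : i < D.n)
    (hr : r < D.numCodes) (hcls : D.color i = D.cls) :
    D.CellCorrect T back D.k (i * D.numCodes + r) :=
  h.step _ (cell_lt hi hr) (by rwa [cell_div hr])

theorem candidate_cell (hj : D.digit j ≤ r) (hr : r < D.numCodes) :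
    D.candidate T (i * D.numCodes + r) j =
      D.obj.op (T (i * D.numCodes + (r - D.digit j))) (D.weight i j) := by
  rw [candidate, cell_div hr, Nat.add_sub_assoc hj]

theorem usable_cell (hr : r < D.numCodes) :
    D.Usable T (i * D.numCodes + r) j ↔
      D.digit j ≤ r ∧ 0 ≤ T (i * D.numCodes + (r - D.digit j)) := by
  rw [Usable, Nat.mul_add_mod_of_lt hr]
  exact and_congr_right fun hj => by rw [Nat.add_sub_assoc hj]

theorem TableCorrect.le_cost (h : D.TableCorrect (D.n * D.numCodes) T back)
    (hτ : ∀ i < D.n, τ i < D.k) (hi : i ≤ D.n) (hcode : D.code τ i < D.numCodes) :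
    0 ≤ T (i * D.numCodes + D.code τ i) ∧ T (i * D.numCodes + D.code τ i) ≤ D.cost τ i := by
  induction i with
  | zero => simp [code, classCode, cost, Objective.total, h.zero]
  | succ i ih =>
    by_cases hcls : D.color i = D.cls
    · have hsucc := code_succ_of_eq (τ := τ) hcls
      obtain ⟨hnonneg, hle⟩ := ih (by omega) (by omega)
      have hprev : D.code τ (i + 1) - D.digit (τ i) = D.code τ i := by omega
      have husable : D.Usable T (i * D.numCodes + D.code τ (i + 1)) (τ i) := by
        rw [usable_cell hcode, hprev]
        exact ⟨by omega, hnonneg⟩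
      rw [Nat.succ_mul, Nat.add_right_comm, cost_succ_of_eq hcls]
      rcases h.cellCorrect hi hcode hcls with ⟨-, hnone⟩ | ⟨hnonneg', -, -, -, hmin⟩
      · exact absurd husable (hnone _ (hτ i hi))
      · refine ⟨hnonneg', (hmin _ (hτ i hi) husable).trans ?_⟩
        rw [candidate_cell (by omega) hcode, hprev]
        exact D.obj.op_mono hle _
    · rw [code_succ_of_ne hcls] at hcode ⊢
      obtain ⟨hnonneg, hle⟩ := ih (by omega) hcode
      rw [h.eq_of_ne hi hcode hcls, cost_succ_of_ne hcls (hnonneg.trans hle)]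
      exact ⟨hnonneg, hle⟩

theorem Traced.init (hr : r < D.numCodes) (h : 0 ≤ T (D.n * D.numCodes + r)) (σ : ℕ → ℕ) :
    D.Traced T r D.n r σ :=
  ⟨hr, h, fun _ hlt hle => absurd hle hlt.not_ge, fun _ _ hcode hcost => ⟨hcode, hcost⟩⟩

theorem Traced.skip (ht : D.Traced T r (i + 1) rc σ)
    (h : D.TableCorrect (D.n * D.numCodes) T back) (hi : i < D.n) (hcls : D.color i ≠ D.cls) :
    D.Traced T r i rc σ := by
  have hT := h.eq_of_ne hi ht.lt hcls
  have hnonneg : 0 ≤ T (i * D.numCodes + rc) := hT ▸ ht.nonneg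
  refine ⟨ht.lt, hnonneg, fun i' hlt hle heq => ht.center_lt i' hlt ?_ heq, fun τ hτ hcode hcost =>
    ht.extend τ (fun i' hlt hle => hτ i' hlt (by omega)) ?_ ?_⟩
  · exact hle.lt_of_ne fun hii => hcls (hii ▸ heq)
  · rw [code_succ_of_ne hcls, hcode]
  · rw [cost_succ_of_ne hcls (hcost ▸ hnonneg), hcost, hT]

theorem Traced.step (ht : D.Traced T r (i + 1) rc σ)
    (h : D.TableCorrect (D.n * D.numCodes) T back) (hi : i < D.n) (hcls : D.color i = D.cls)
    (hj : back (i * D.numCodes + rc) = j) :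
    D.Traced T r i (rc - D.digit j) (Function.update σ i j) := by
  have hlt := ht.lt
  have hidx : (i + 1) * D.numCodes + rc = i * D.numCodes + rc + D.numCodes := by ring
  rcases h.cellCorrect hi hlt hcls with ⟨hneg, -⟩ | ⟨-, hjk, husable, heq, -⟩
  · exact absurd (hidx ▸ ht.nonneg) hneg.not_ge
  rw [hj] at hjk husable heq
  rw [usable_cell hlt] at husable
  rw [candidate_cell husable.1 hlt] at heq
  refine ⟨by omega, husable.2, fun i' hi' hle hcls' => ?_, fun τ hτ hcode hcost =>
    ht.extend τ (fun i' hi' hle hcls' => ?_) ?_ ?_⟩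
  · rcases eq_or_ne i' i with rfl | hne
    · rwa [Function.update_self]
    · rw [Function.update_of_ne hne]
      exact ht.center_lt i' hi' (by omega) hcls'
  · rw [hτ i' hi' (by omega) hcls', Function.update_of_ne (by omega)]
  all_goals have hτi : τ i = j := by rw [hτ i hi le_rfl hcls, Function.update_self]
  · rw [code_succ_of_eq hcls, hcode, hτi, Nat.sub_add_cancel husable.1]
  · rw [cost_succ_of_eq hcls, hcost, hτi, hidx, heq]

theorem Traced.isOptimal (ht : D.Traced T r 0 rc σ)
    (h : D.TableCorrect (D.n * D.numCodes) T back) (hr : r < D.numCodes) : D.IsOptimal r σ := by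
  obtain rfl : rc = 0 := by
    by_contra hrc
    refine (h.neg rc (Nat.pos_of_ne_zero hrc) ht.lt).not_ge ?_
    simpa only [zero_mul, zero_add] using ht.nonneg
  obtain ⟨hcode, hcost⟩ := ht.extend σ (fun _ _ _ _ => rfl) rfl
    (by rw [zero_mul, zero_add, h.zero]; rfl)
  refine ⟨fun i hi => ht.center_lt i hi (Nat.zero_le i), hcode, fun τ hτ hτr => ?_⟩
  rw [hcost, ← hτr]
  exact (h.le_cost hτ le_rfl (hτr ▸ hr)).2

end ClassProblem

/-! ### Means of few points as approximate centers -/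

/-- The number of points whose mean is used as the center of a cluster. -/
noncomputable def sampleSize (ε : ℝ) : ℕ := ⌈1 / (ε * ε)⌉₊

theorem one_le_sampleSize {ε : ℝ} (hε : 0 < ε) : 1 ≤ sampleSize ε :=
  Nat.ceil_pos.2 (by positivity)

theorem inv_sampleSize_le_sq {ε : ℝ} (hε : 0 < ε) : (sampleSize ε : ℝ)⁻¹ ≤ ε ^ 2 := by
  have hceil : 1 / (ε * ε) ≤ sampleSize ε := Nat.le_ceil _
  calc (sampleSize ε : ℝ)⁻¹ ≤ (1 / (ε * ε))⁻¹ := by gcongr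
    _ = ε ^ 2 := by rw [one_div, inv_inv, sq]

theorem inv_sampleSize_le {ε : ℝ} (hε : 0 < ε) : (sampleSize ε : ℝ)⁻¹ ≤ ε := by
  rcases le_total ε 1 with h | h
  · exact (inv_sampleSize_le_sq hε).trans (by nlinarith)
  · exact (inv_le_one_of_one_le₀ (mod_cast one_le_sampleSize hε)).trans h

theorem sum_inv_card {ι : Type*} {S : Finset ι} (hS : S.Nonempty) :
    ∑ _i ∈ S, (S.card : ℝ)⁻¹ = 1 := by
  rw [Finset.sum_const, nsmul_eq_mul, mul_inv_cancel₀ (mod_cast hS.card_ne_zero)]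

theorem exists_mem_le_sum_mul {ι : Type*} {S : Finset ι} {μ : ι → ℝ} (hμ : ∀ i ∈ S, 0 ≤ μ i)
    (hμ₁ : ∑ i ∈ S, μ i = 1) (f : ι → ℝ) : ∃ i ∈ S, f i ≤ ∑ i ∈ S, μ i * f i := by
  obtain ⟨i, hi, hle⟩ := (concaveOn_id (𝕜 := ℝ) convex_univ).exists_le_of_centerMass
    (p := f) hμ (hμ₁ ▸ one_pos) fun _ _ => Set.mem_univ _
  exact ⟨i, hi, by simpa only [id, Finset.centerMass_eq_of_sum_1 S f hμ₁, smul_eq_mul] using hle⟩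

section

variable {E ι : Type*} [NormedAddCommGroup E]

/-- The weight of `x i` in one step of Weiszfeld's algorithm for the geometric median, started
at `c`. -/
noncomputable def weiszfeldWeight (S : Finset ι) (x : ι → E) (c : E) (i : ι) : ℝ :=
  ‖x i - c‖⁻¹ / ∑ i ∈ S, ‖x i - c‖⁻¹

theorem weiszfeldWeight_nonneg (S : Finset ι) (x : ι → E) (c : E) (i : ι) :
    0 ≤ weiszfeldWeight S x c i :=
  div_nonneg (by positivity) (Finset.sum_nonneg fun _ _ => by positivity)

section

variable {S : Finset ι} {x : ι → E} {c : E} (hc : ∀ i ∈ S, x i ≠ c)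

include hc

theorem norm_sub_pos_of_mem {i : ι} (hi : i ∈ S) : 0 < ‖x i - c‖ :=
  norm_pos_iff.2 (sub_ne_zero.2 (hc i hi))

theorem sum_inv_norm_sub_pos (hS : S.Nonempty) : 0 < ∑ i ∈ S, ‖x i - c‖⁻¹ :=
  Finset.sum_pos (fun _ hi => inv_pos.2 (norm_sub_pos_of_mem hc hi)) hS

theorem sq_card_le_sum_norm_sub_mul_sum_inv (hS : S.Nonempty) :
    (S.card : ℝ) ^ 2 ≤ (∑ i ∈ S, ‖x i - c‖) * ∑ i ∈ S, ‖x i - c‖⁻¹ := by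
  have hF : 0 < ∑ i ∈ S, ‖x i - c‖ := Finset.sum_pos (fun _ => norm_sub_pos_of_mem hc) hS
  have h := Finset.sq_sum_div_le_sum_sq_div S (fun _ => (1 : ℝ)) fun _ => norm_sub_pos_of_mem hc
  simp only [Finset.sum_const, nsmul_eq_mul, mul_one, one_pow, one_div] at h
  rwa [div_le_iff₀' hF] at h

theorem sum_weiszfeldWeight (hS : S.Nonempty) : ∑ i ∈ S, weiszfeldWeight S x c i = 1 := by
  simp only [weiszfeldWeight]
  rw [← Finset.sum_div, div_self (sum_inv_norm_sub_pos hc hS).ne']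

end

open scoped InnerProductSpace

variable [InnerProductSpace ℝ E]

/-- The mean of the points `x (g 0), …, x (g (m - 1))`. -/
noncomputable def sampleMean (x : ι → E) (m : ℕ) (g : ℕ → ι) : E :=
  (m : ℝ)⁻¹ • ∑ t ∈ Finset.range m, x (g t)

theorem sampleMean_sub (x : ι → E) {m : ℕ} (hm : 1 ≤ m) (g : ℕ → ι) (p : E) :
    sampleMean x m g - p = (m : ℝ)⁻¹ • ∑ t ∈ Finset.range m, (x (g t) - p) := by
  have hm₀ : (m : ℝ) ≠ 0 := by positivity
  rw [sampleMean, Finset.sum_sub_distrib, smul_sub, Finset.sum_const, Finset.card_range,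
    ← Nat.cast_smul_eq_nsmul ℝ, inv_smul_smul₀ hm₀]

theorem sampleMean_const (x : ι → E) {m : ℕ} (hm : 1 ≤ m) (i : ι) :
    sampleMean x m (fun _ => i) = x i := by
  rw [← sub_eq_zero, sampleMean_sub x hm, sub_self, Finset.sum_const_zero, smul_zero]

theorem sum_mul_norm_sub_sq_eq {S : Finset ι} {μ : ι → ℝ} {x : ι → E} {p : E}
    (hμ₁ : ∑ i ∈ S, μ i = 1) (hp : ∑ i ∈ S, μ i • x i = p) (v : E) :
    ∑ i ∈ S, μ i * ‖x i - v‖ ^ 2 = ∑ i ∈ S, μ i * ‖x i - p‖ ^ 2 + ‖p - v‖ ^ 2 := by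
  have hdev : ∑ i ∈ S, μ i • (x i - p) = 0 := by
    simp only [smul_sub, Finset.sum_sub_distrib, hp, ← Finset.sum_smul, hμ₁, one_smul, sub_self]
  have hcross : ∑ i ∈ S, μ i * ⟪x i - p, p - v⟫_ℝ = 0 := by
    simpa only [sum_inner, real_inner_smul_left, inner_zero_left] using
      congrArg (fun z => ⟪z, p - v⟫_ℝ) hdev
  calc ∑ i ∈ S, μ i * ‖x i - v‖ ^ 2
      = ∑ i ∈ S, (μ i * ‖x i - p‖ ^ 2 + 2 * (μ i * ⟪x i - p, p - v⟫_ℝ) + μ i * ‖p - v‖ ^ 2) := by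
        refine Finset.sum_congr rfl fun i _ => ?_
        rw [← sub_add_sub_cancel (x i) p v, norm_add_sq_real]
        ring
    _ = ∑ i ∈ S, μ i * ‖x i - p‖ ^ 2 + ‖p - v‖ ^ 2 := by
        rw [Finset.sum_add_distrib, Finset.sum_add_distrib, ← Finset.mul_sum, hcross,
          ← Finset.sum_mul, hμ₁, mul_zero, add_zero, one_mul]

/-- If the sample is drawn independently with probabilities `μ`, the left-hand side has the
right-hand side as its mean. The induction chooses one point after the other without exceeding
the conditional mean. -/
theorem exists_norm_sum_sub_sq_le {S : Finset ι} {μ : ι → ℝ} {x : ι → E} {p : E}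
    (hμ : ∀ i ∈ S, 0 ≤ μ i) (hμ₁ : ∑ i ∈ S, μ i = 1) (hp : ∑ i ∈ S, μ i • x i = p) (m : ℕ) :
    ∃ g : ℕ → ι, (∀ t, g t ∈ S) ∧
      ‖∑ t ∈ Finset.range m, (x (g t) - p)‖ ^ 2 ≤ m * ∑ i ∈ S, μ i * ‖x i - p‖ ^ 2 := by
  induction m with
  | zero =>
    obtain ⟨i, hi⟩ := Finset.nonempty_of_sum_ne_zero (hμ₁.trans_ne one_ne_zero)
    exact ⟨fun _ => i, fun _ => hi, by simp⟩
  | succ m ih =>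
    obtain ⟨g, hg, hle⟩ := ih
    set v := ∑ t ∈ Finset.range m, (x (g t) - p)
    obtain ⟨i, hi, hiv⟩ := exists_mem_le_sum_mul hμ hμ₁ fun i => ‖x i - (p - v)‖ ^ 2
    rw [sum_mul_norm_sub_sq_eq hμ₁ hp, sub_sub_cancel, ← sub_add, add_comm _ v] at hiv
    refine ⟨Function.update g m i, fun t => ?_, ?_⟩
    · rcases eq_or_ne t m with rfl | ht
      · rwa [Function.update_self]
      · rw [Function.update_of_ne ht]
        exact hg t
    · have hinit : ∑ t ∈ Finset.range m, (x (Function.update g m i t) - p) = v :=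
        Finset.sum_congr rfl fun t ht => by
          rw [Function.update_of_ne (Finset.mem_range.1 ht).ne]
      rw [Finset.sum_range_succ, hinit, Function.update_self]
      push_cast
      linarith

theorem exists_norm_sampleMean_sub_sq_le {S : Finset ι} {μ : ι → ℝ} {x : ι → E} {p : E}
    (hμ : ∀ i ∈ S, 0 ≤ μ i) (hμ₁ : ∑ i ∈ S, μ i = 1) (hp : ∑ i ∈ S, μ i • x i = p) {m : ℕ}
    (hm : 1 ≤ m) :
    ∃ g : ℕ → ι, (∀ t, g t ∈ S) ∧
      ‖sampleMean x m g - p‖ ^ 2 ≤ (m : ℝ)⁻¹ * ∑ i ∈ S, μ i * ‖x i - p‖ ^ 2 := by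
  obtain ⟨g, hg, hle⟩ := exists_norm_sum_sub_sq_le hμ hμ₁ hp m
  have : (0 : ℝ) < m := by positivity
  refine ⟨g, hg, ?_⟩
  rw [sampleMean_sub x hm, norm_smul, mul_pow, norm_inv, Real.norm_natCast]
  calc (m : ℝ)⁻¹ ^ 2 * ‖∑ t ∈ Finset.range m, (x (g t) - p)‖ ^ 2
      ≤ (m : ℝ)⁻¹ ^ 2 * (m * ∑ i ∈ S, μ i * ‖x i - p‖ ^ 2) := by gcongr
    _ = _ := by field_simp

theorem norm_sub_sampleMean_le (x : ι → E) (i : ι) (m : ℕ) (g : ℕ → ι) (p : E) :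
    ‖x i - sampleMean x m g‖ ≤ ‖x i - p‖ + ‖sampleMean x m g - p‖ := by
  rw [norm_sub_rev (sampleMean x m g) p]
  exact norm_sub_le_norm_sub_add_norm_sub _ _ _

theorem sum_norm_sub_sq_eq {S : Finset ι} (hS : S.Nonempty) (x : ι → E) (v : E) :
    ∑ i ∈ S, ‖x i - v‖ ^ 2 = ∑ i ∈ S, ‖x i - ∑ i ∈ S, (S.card : ℝ)⁻¹ • x i‖ ^ 2 +
      S.card * ‖∑ i ∈ S, (S.card : ℝ)⁻¹ • x i - v‖ ^ 2 := by
  have hcard : (S.card : ℝ) ≠ 0 := mod_cast hS.card_ne_zero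
  have h := sum_mul_norm_sub_sq_eq (sum_inv_card hS) (p := ∑ i ∈ S, (S.card : ℝ)⁻¹ • x i) rfl v
  rwa [← Finset.mul_sum, ← Finset.mul_sum, inv_mul_eq_iff_eq_mul₀ hcard, mul_add,
    mul_inv_cancel_left₀ hcard] at h

theorem exists_sampleMean_kMeans {S : Finset ι} (hS : S.Nonempty) (x : ι → E) (c : E) {ε : ℝ}
    (hε : 0 < ε) : ∃ g : ℕ → ι, (∀ t, g t ∈ S) ∧
      ∑ i ∈ S, ‖x i - sampleMean x (sampleSize ε) g‖ ^ 2 ≤ (1 + ε) * ∑ i ∈ S, ‖x i - c‖ ^ 2 := by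
  have hcard : (0 : ℝ) < S.card := mod_cast hS.card_pos
  obtain ⟨g, hg, hle⟩ := exists_norm_sampleMean_sub_sq_le (x := x)
    (fun _ _ => (inv_pos.2 hcard).le) (sum_inv_card hS) rfl (one_le_sampleSize hε)
  refine ⟨g, hg, ?_⟩
  rw [sum_norm_sub_sq_eq hS x (sampleMean x _ g), sum_norm_sub_sq_eq hS x c]
  rw [← Finset.mul_sum, norm_sub_rev] at hle
  generalize (∑ i ∈ S, (S.card : ℝ)⁻¹ • x i) = p at hle ⊢
  have hV : 0 ≤ ∑ i ∈ S, ‖x i - p‖ ^ 2 := by positivity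
  generalize (∑ i ∈ S, ‖x i - p‖ ^ 2) = V at hle hV ⊢
  calc V + S.card * ‖p - sampleMean x (sampleSize ε) g‖ ^ 2
      ≤ V + S.card * (ε * ((S.card : ℝ)⁻¹ * V)) := by
        gcongr
        exact hle.trans (by gcongr; exact inv_sampleSize_le hε)
    _ = (1 + ε) * V := by field_simp
    _ ≤ (1 + ε) * (V + S.card * ‖p - c‖ ^ 2) := by
        gcongr
        exact le_add_of_nonneg_right (by positivity)

/-- The point to which one step of Weiszfeld's algorithm for the geometric median moves `c`. -/
noncomputable def weiszfeldPoint (S : Finset ι) (x : ι → E) (c : E) : E :=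
  ∑ i ∈ S, weiszfeldWeight S x c i • x i

section Weiszfeld

variable {S : Finset ι} (hS : S.Nonempty) {x : ι → E} {c : E} (hc : ∀ i ∈ S, x i ≠ c)

include hS hc

theorem sum_weiszfeldWeight_mul_norm_sub_sq_le :
    ∑ i ∈ S, weiszfeldWeight S x c i * ‖x i - weiszfeldPoint S x c‖ ^ 2 ≤
      (∑ i ∈ S, ‖x i - c‖) / ∑ i ∈ S, ‖x i - c‖⁻¹ := by
  have hc_eq : ∑ i ∈ S, weiszfeldWeight S x c i * ‖x i - c‖ ^ 2 =
      (∑ i ∈ S, ‖x i - c‖) / ∑ i ∈ S, ‖x i - c‖⁻¹ := by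
    rw [Finset.sum_div]
    refine Finset.sum_congr rfl fun i hi => ?_
    have hi₀ := (norm_sub_pos_of_mem hc hi).ne'
    rw [weiszfeldWeight]
    field_simp
  rw [← hc_eq, sum_mul_norm_sub_sq_eq (sum_weiszfeldWeight hc hS) rfl c]
  exact le_add_of_nonneg_right (sq_nonneg _)

theorem sum_norm_sub_weiszfeldPoint_le :
    ∑ i ∈ S, ‖x i - weiszfeldPoint S x c‖ ≤ ∑ i ∈ S, ‖x i - c‖ := by
  set p := weiszfeldPoint S x c
  set F := ∑ i ∈ S, ‖x i - c‖
  set W := ∑ i ∈ S, ‖x i - c‖⁻¹ with hW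
  have hW₀ : 0 < W := sum_inv_norm_sub_pos hc hS
  -- AM-GM: `s ≤ s ^ 2 / (2 * r) + r / 2` with `s = ‖x i - p‖` and `r = ‖x i - c‖`
  have hterm : ∀ i ∈ S, ‖x i - p‖ ≤
      W / 2 * (weiszfeldWeight S x c i * ‖x i - p‖ ^ 2) + ‖x i - c‖ / 2 := by
    intro i hi
    have hr := norm_sub_pos_of_mem hc hi
    have heq : W / 2 * (weiszfeldWeight S x c i * ‖x i - p‖ ^ 2) =
        ‖x i - p‖ ^ 2 / (2 * ‖x i - c‖) := by
      rw [weiszfeldWeight, ← hW]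
      field_simp
    rw [heq, div_add_div _ _ (by positivity) two_ne_zero, le_div_iff₀ (by positivity)]
    nlinarith [sq_nonneg (‖x i - p‖ - ‖x i - c‖)]
  calc ∑ i ∈ S, ‖x i - p‖
      ≤ W / 2 * ∑ i ∈ S, weiszfeldWeight S x c i * ‖x i - p‖ ^ 2 + F / 2 := by
        refine (Finset.sum_le_sum hterm).trans_eq ?_
        rw [Finset.sum_add_distrib, ← Finset.mul_sum, ← Finset.sum_div]
    _ ≤ W / 2 * (F / W) + F / 2 := by
        gcongr
        exact sum_weiszfeldWeight_mul_norm_sub_sq_le hS hc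
    _ = F := by field_simp; ring

theorem exists_card_mul_norm_sampleMean_sub_le {ε : ℝ} (hε : 0 < ε) :
    ∃ g : ℕ → ι, (∀ t, g t ∈ S) ∧
      S.card * ‖sampleMean x (sampleSize ε) g - weiszfeldPoint S x c‖ ≤
        ε * ∑ i ∈ S, ‖x i - c‖ := by
  obtain ⟨g, hg, hle⟩ := exists_norm_sampleMean_sub_sq_le (x := x)
    (fun i _ => weiszfeldWeight_nonneg S x c i) (sum_weiszfeldWeight hc hS)
    (p := weiszfeldPoint S x c) rfl (one_le_sampleSize hε)
  have hvar := sum_weiszfeldWeight_mul_norm_sub_sq_le hS hc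
  have hcard := sq_card_le_sum_norm_sub_mul_sum_inv hc hS
  have hW₀ := sum_inv_norm_sub_pos hc hS
  set F := ∑ i ∈ S, ‖x i - c‖
  set W := ∑ i ∈ S, ‖x i - c‖⁻¹
  have : 0 ≤ F := Finset.sum_nonneg fun _ _ => norm_nonneg _
  refine ⟨g, hg, le_of_sq_le_sq ?_ (by positivity)⟩
  calc (S.card * ‖sampleMean x (sampleSize ε) g - weiszfeldPoint S x c‖) ^ 2
      = S.card ^ 2 * ‖sampleMean x (sampleSize ε) g - weiszfeldPoint S x c‖ ^ 2 := mul_pow _ _ 2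
    _ ≤ (F * W) * (ε ^ 2 * (F / W)) := by
        gcongr
        exact hle.trans (mul_le_mul (inv_sampleSize_le_sq hε) hvar
          (Finset.sum_nonneg fun i _ => mul_nonneg (weiszfeldWeight_nonneg S x c i) (sq_nonneg _))
          (sq_nonneg ε))
    _ = (ε * F) ^ 2 := by field_simp

end Weiszfeld

theorem exists_sampleMean_kMedian {S : Finset ι} (hS : S.Nonempty) (x : ι → E) (c : E) {ε : ℝ}
    (hε : 0 < ε) : ∃ g : ℕ → ι, (∀ t, g t ∈ S) ∧
      ∑ i ∈ S, ‖x i - sampleMean x (sampleSize ε) g‖ ≤ (1 + ε) * ∑ i ∈ S, ‖x i - c‖ := by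
  by_cases hc : ∃ i ∈ S, x i = c
  · obtain ⟨i, hi, rfl⟩ := hc
    refine ⟨fun _ => i, fun _ => hi, ?_⟩
    rw [sampleMean_const x (one_le_sampleSize hε)]
    exact le_mul_of_one_le_left (Finset.sum_nonneg fun _ _ => norm_nonneg _) (by linarith)
  push Not at hc
  obtain ⟨g, hg, hle⟩ := exists_card_mul_norm_sampleMean_sub_le hS hc hε
  refine ⟨g, hg, ?_⟩
  set p := weiszfeldPoint S x c
  calc ∑ i ∈ S, ‖x i - sampleMean x (sampleSize ε) g‖
      ≤ ∑ i ∈ S, (‖x i - p‖ + ‖sampleMean x (sampleSize ε) g - p‖) :=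
        Finset.sum_le_sum fun i _ => norm_sub_sampleMean_le x i _ g p
    _ = ∑ i ∈ S, ‖x i - p‖ + S.card * ‖sampleMean x (sampleSize ε) g - p‖ := by
        rw [Finset.sum_add_distrib, Finset.sum_const, nsmul_eq_mul]
    _ ≤ ∑ i ∈ S, ‖x i - c‖ + ε * ∑ i ∈ S, ‖x i - c‖ :=
        add_le_add (sum_norm_sub_weiszfeldPoint_le hS hc) hle
    _ = (1 + ε) * ∑ i ∈ S, ‖x i - c‖ := by ring

theorem exists_mem_forall_norm_sub_le {K : Set E} (hne : K.Nonempty)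
    (hcomplete : IsComplete K) (hconvex : Convex ℝ K) (c : E) :
    ∃ p ∈ K, ∀ y ∈ K, ‖y - p‖ ≤ ‖y - c‖ := by
  obtain ⟨p, hpK, hp⟩ := exists_norm_eq_iInf_of_complete_convex hne hcomplete hconvex c
  rw [norm_eq_iInf_iff_real_inner_le_zero hconvex hpK] at hp
  refine ⟨p, hpK, fun y hy => le_of_sq_le_sq ?_ (norm_nonneg _)⟩
  have hinner : ⟪y - p, c - p⟫_ℝ ≤ 0 := real_inner_comm (y - p) (c - p) ▸ hp y hy
  calc ‖y - p‖ ^ 2 ≤ ‖y - p‖ ^ 2 - 2 * ⟪y - p, c - p⟫_ℝ + ‖c - p‖ ^ 2 := by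
        linarith [sq_nonneg ‖c - p‖]
    _ = ‖y - c‖ ^ 2 := by rw [← norm_sub_sq_real, sub_sub_sub_cancel_right]

theorem exists_mem_stdSimplex_forall_norm_sub_le [Fintype ι] [Nonempty ι] (x : ι → E) (c : E) :
    ∃ μ ∈ stdSimplex ℝ ι, ∀ i, ‖x i - ∑ i, μ i • x i‖ ≤ ‖x i - c‖ := by
  classical
  let L := Fintype.linearCombination ℝ x
  have hcompact : IsCompact (L '' stdSimplex ℝ ι) :=
    (isCompact_stdSimplex ℝ ι).image L.continuous_of_finiteDimensional
  have hmem (i : ι) : x i ∈ L '' stdSimplex ℝ ι :=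
    ⟨Pi.single i 1, single_mem_stdSimplex ℝ i, by
      rw [Fintype.linearCombination_apply_single, one_smul]⟩
  obtain ⟨_, ⟨μ, hμ, rfl⟩, hle⟩ := exists_mem_forall_norm_sub_le ⟨_, hmem (Classical.arbitrary ι)⟩
    hcompact.isComplete ((convex_stdSimplex ℝ ι).linear_image L) c
  exact ⟨μ, hμ, fun i => hle (x i) (hmem i)⟩

theorem exists_sampleMean_kCenter {S : Finset ι} (hS : S.Nonempty) (x : ι → E) (c : E) {ε r : ℝ}
    (hε : 0 < ε) (hr : ∀ i ∈ S, ‖x i - c‖ ≤ r) : ∃ g : ℕ → ι, (∀ t, g t ∈ S) ∧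
      ∀ i ∈ S, ‖x i - sampleMean x (sampleSize ε) g‖ ≤ (1 + ε) * r := by
  have : Nonempty S := hS.to_subtype
  have hr₀ : 0 ≤ r := (norm_nonneg _).trans (hr _ hS.choose_spec)
  obtain ⟨μ, ⟨hμ, hμ₁⟩, hpc⟩ := exists_mem_stdSimplex_forall_norm_sub_le (fun i : S => x i) c
  obtain ⟨g, -, hle⟩ := exists_norm_sampleMean_sub_sq_le (S := Finset.univ)
    (x := fun i : S => x i) (fun i _ => hμ i) hμ₁ rfl (one_le_sampleSize hε)
  set p := ∑ i : S, μ i • x i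
  have hvar : ∑ i, μ i * ‖x i - p‖ ^ 2 ≤ r ^ 2 :=
    calc ∑ i, μ i * ‖x i - p‖ ^ 2 ≤ ∑ i, μ i * r ^ 2 :=
          Finset.sum_le_sum fun i _ => mul_le_mul_of_nonneg_left
            (pow_le_pow_left₀ (norm_nonneg _) ((hpc i).trans (hr i i.2)) 2) (hμ i)
      _ = r ^ 2 := by rw [← Finset.sum_mul, hμ₁, one_mul]
  have hdist : ‖sampleMean (fun i : S => x i) (sampleSize ε) g - p‖ ≤ ε * r := by
    refine le_of_sq_le_sq (hle.trans ?_) (by positivity)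
    rw [mul_pow]
    exact mul_le_mul (inv_sampleSize_le_sq hε) hvar
      (Finset.sum_nonneg fun i _ => mul_nonneg (hμ i) (sq_nonneg _)) (sq_nonneg ε)
  refine ⟨fun t => g t, fun t => (g t).2, fun i hi => ?_⟩
  refine (norm_sub_sampleMean_le (fun i : S => x i) ⟨i, hi⟩ (sampleSize ε) g p).trans ?_
  linarith [hpc ⟨i, hi⟩, hr i hi]

end

/-! ### Costs of clusterings -/

/-- The cost of a point as a function of its squared distance to the center. -/
noncomputable def Objective.weight (obj : Objective) (x : ℝ) : ℝ :=
  match obj with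
  | .kMeans => x
  | _ => √x

theorem Objective.weight_nonneg (obj : Objective) {x : ℝ} (hx : 0 ≤ x) : 0 ≤ obj.weight x := by
  cases obj
  · exact Real.sqrt_nonneg x
  · exact hx
  · exact Real.sqrt_nonneg x

theorem Objective.total_eq_cost {n d : ℕ} (obj : Objective)
    (A C : Fin n → EuclideanSpace ℝ (Fin d)) {f : ℕ → ℝ}
    (hf : ∀ i : Fin n, f i = obj.weight (‖A i - C i‖ ^ 2)) : obj.total f n = obj.cost A C := by
  cases obj with
  | kMedian =>
    rw [total_eq_sum (by simp), ← Fin.sum_univ_eq_sum_range]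
    exact Finset.sum_congr rfl fun i _ => (hf i).trans (Real.sqrt_sq (norm_nonneg _))
  | kMeans =>
    rw [total_eq_sum (by simp), ← Fin.sum_univ_eq_sum_range]
    exact Finset.sum_congr rfl fun i _ => hf i
  | kCenter =>
    replace hf (i : Fin n) : f i = ‖A i - C i‖ := (hf i).trans (Real.sqrt_sq (norm_nonneg _))
    have hbdd : BddAbove (Set.range fun i => ‖A i - C i‖) := (Set.finite_range _).bddAbove
    have htotal : 0 ≤ Objective.kCenter.total f n :=
      Objective.kCenter.total_nonneg fun i hi => (hf ⟨i, hi⟩).symm ▸ norm_nonneg _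
    refine le_antisymm ((total_kCenter_le_iff ?_).2 fun i hi => ?_)
      (Real.iSup_le (fun i => ?_) htotal)
    · exact Real.iSup_nonneg fun i => norm_nonneg _
    · exact (hf ⟨i, hi⟩).trans_le (le_ciSup hbdd ⟨i, hi⟩)
    · exact (hf i).ge.trans ((total_kCenter_le_iff htotal).1 le_rfl i i.2)

theorem Objective.cost_nonneg {n d : ℕ} (obj : Objective)
    (A C : Fin n → EuclideanSpace ℝ (Fin d)) : 0 ≤ obj.cost A C := by
  cases obj
  · exact Finset.sum_nonneg fun _ _ => norm_nonneg _
  · exact Finset.sum_nonneg fun _ _ => sq_nonneg _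
  · exact Real.iSup_nonneg fun _ => norm_nonneg _

theorem Objective.cost_self {n d : ℕ} (obj : Objective) (A : Fin n → EuclideanSpace ℝ (Fin d)) :
    obj.cost A A = 0 := by
  cases obj <;> simp [cost]

section

variable {E ι κ : Type*} [NormedAddCommGroup E] [InnerProductSpace ℝ E] [Nonempty ι]

theorem exists_sum_sub_sampleMean_le [Fintype ι] {φ : E → ℝ} {m : ℕ} {δ : ℝ} (A : ι → E)
    (hφ : ∀ S : Finset ι, S.Nonempty → ∀ c, ∃ g : ℕ → ι, (∀ t, g t ∈ S) ∧
      ∑ i ∈ S, φ (A i - sampleMean A m g) ≤ δ * ∑ i ∈ S, φ (A i - c))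
    (τ : ι → κ) (y : κ → E) :
    ∃ g : κ → ℕ → ι,
      ∑ i, φ (A i - sampleMean A m (g (τ i))) ≤ δ * ∑ i, φ (A i - y (τ i)) := by
  classical
  have hcluster (j : κ) : ∃ g : ℕ → ι,
      ∑ i with τ i = j, φ (A i - sampleMean A m g) ≤ δ * ∑ i with τ i = j, φ (A i - y j) := by
    rcases (Finset.univ.filter fun i => τ i = j).eq_empty_or_nonempty with h | h
    · exact ⟨fun _ => Classical.arbitrary ι, by simp [h]⟩
    · obtain ⟨g, -, hg⟩ := hφ _ h (y j)
      exact ⟨g, hg⟩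
  choose g hg using hcluster
  have sum_clusters (u : κ → ι → ℝ) :
      ∑ j ∈ Finset.univ.image τ, ∑ i with τ i = j, u j i = ∑ i, u (τ i) i := by
    rw [← Finset.sum_fiberwise_of_maps_to (g := τ)
      (fun i hi => Finset.mem_image_of_mem τ hi) fun i => u (τ i) i]
    exact Finset.sum_congr rfl fun j _ => Finset.sum_congr rfl fun i hi => by
      rw [(Finset.mem_filter.1 hi).2]
  refine ⟨g, ?_⟩
  rw [← sum_clusters fun j i => φ (A i - sampleMean A m (g j)),
    ← sum_clusters fun j i => φ (A i - y j), Finset.mul_sum]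
  exact Finset.sum_le_sum fun j _ => hg j

theorem exists_iSup_norm_sub_sampleMean_le [Finite ι] {ε : ℝ} (hε : 0 < ε) (A : ι → E)
    (τ : ι → κ) (y : κ → E) :
    ∃ g : κ → ℕ → ι, ⨆ i, ‖A i - sampleMean A (sampleSize ε) (g (τ i))‖ ≤
      (1 + ε) * ⨆ i, ‖A i - y (τ i)‖ := by
  classical
  have := Fintype.ofFinite ι
  have hcluster (j : κ) : ∃ g : ℕ → ι, ∀ i, τ i = j →
      ‖A i - sampleMean A (sampleSize ε) g‖ ≤ (1 + ε) * ⨆ i, ‖A i - y (τ i)‖ := by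
    rcases (Finset.univ.filter fun i => τ i = j).eq_empty_or_nonempty with h | h
    · exact ⟨fun _ => Classical.arbitrary ι, fun i hi => absurd hi
        (Finset.filter_eq_empty_iff.1 h (Finset.mem_univ i))⟩
    · obtain ⟨g, -, hg⟩ := exists_sampleMean_kCenter h A (y j) hε fun i hi => by
        rw [← (Finset.mem_filter.1 hi).2]
        exact le_ciSup (f := fun i => ‖A i - y (τ i)‖) (Set.finite_range _).bddAbove i
      exact ⟨g, fun i hi => hg i (Finset.mem_filter.2 ⟨Finset.mem_univ i, hi⟩)⟩
  choose g hg using hcluster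
  exact ⟨g, ciSup_le fun i => hg _ i rfl⟩

end

theorem Objective.exists_cost_sampleMean_le {n d : ℕ} {κ : Type*} [Nonempty (Fin n)]
    (obj : Objective) (A : Fin n → EuclideanSpace ℝ (Fin d)) (τ : Fin n → κ)
    (y : κ → EuclideanSpace ℝ (Fin d)) {ε : ℝ} (hε : 0 < ε) :
    ∃ g : κ → ℕ → Fin n, obj.cost A (fun i => sampleMean A (sampleSize ε) (g (τ i))) ≤
      (1 + ε) * obj.cost A fun i => y (τ i) := by
  cases obj with
  | kMedian =>
    exact exists_sum_sub_sampleMean_le (φ := fun v => ‖v‖) A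
      (fun S hS c => exists_sampleMean_kMedian hS A c hε) τ y
  | kMeans =>
    exact exists_sum_sub_sampleMean_le (φ := fun v => ‖v‖ ^ 2) A
      (fun S hS c => exists_sampleMean_kMeans hS A c hε) τ y
  | kCenter => exact exists_iSup_norm_sub_sampleMean_le hε A τ y

/-! ### Fairness and codes -/

section

variable {n ℓ k d : ℕ} (c : Fin n → Fin ℓ)

/-- The number of points of colour `a` that are assigned to the center `j`, as a digit in base
`n + 1`. -/
def colorCount (τ : Fin n → Fin k) (a : Fin ℓ) (j : Fin k) : Fin (n + 1) :=
  ⟨(Finset.univ.filter fun i => c i = a ∧ τ i = j).card,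
    Nat.lt_succ_of_le ((Finset.card_le_univ _).trans (Fintype.card_fin n).le)⟩

theorem classCode_eq_finFunctionFinEquiv {color : ℕ → ℕ} (hcolor : ∀ i : Fin n, color i = c i)
    (τ : Fin n → Fin k) {σ : ℕ → ℕ} (hσ : ∀ i : Fin n, σ i = τ i) (a : Fin ℓ) :
    classCode color (fun j => (n + 1) ^ j) a σ n = finFunctionFinEquiv (colorCount c τ a) := by
  rw [classCode, Finset.sum_filter,
    ← Fin.sum_univ_eq_sum_range (fun i => if color i = a then (n + 1) ^ σ i else 0),
    finFunctionFinEquiv_apply, ← Finset.sum_fiberwise _ τ]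
  refine Finset.sum_congr rfl fun j _ => ?_
  simp only [colorCount, hcolor, hσ, Fin.val_inj]
  rw [← Finset.sum_filter, Finset.filter_filter, ← smul_eq_mul, ← Finset.sum_const]
  refine Finset.sum_congr (by simp only [and_comm]) fun i hi => ?_
  rw [(Finset.mem_filter.1 hi).2.2]

theorem card_filter_eq_sum_colorCount (τ : Fin n → Fin k) (a : Fin ℓ) (p : Fin k → Prop)
    [DecidablePred p] :
    ((Finset.univ.filter fun i => p (τ i)).filter fun i => c i = a).card =
      ∑ j with p j, (colorCount c τ a j : ℕ) := by
  rw [Finset.card_eq_sum_card_fiberwise (f := τ) (t := Finset.univ.filter p)]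
  · refine Finset.sum_congr rfl fun j hj => ?_
    have hpj := (Finset.mem_filter.1 hj).2
    simp only [colorCount]
    congr 1
    ext i
    simp only [Finset.mem_filter, Finset.mem_univ, true_and]
    exact ⟨fun h => ⟨h.1.2, h.2⟩, fun h => ⟨⟨h.2 ▸ hpj, h.1⟩, h.2⟩⟩
  · intro i hi
    simp only [Finset.coe_filter, Finset.mem_filter, Set.mem_ofPred_eq, Finset.mem_univ,
      true_and] at hi ⊢
    exact hi.1

variable {c}

theorem isFairClustering_of_colorCount_eq {τ : Fin n → Fin k}
    (h : ∀ a b, colorCount c τ a = colorCount c τ b) (y : Fin k → EuclideanSpace ℝ (Fin d)) :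
    IsFairClustering k c fun i => y (τ i) := by
  classical
  refine ⟨?_, fun i₀ a b => ?_⟩
  · calc (Finset.univ.image (y ∘ τ)).card ≤ (Finset.univ.image y).card := by
          rw [← Finset.image_image]
          exact Finset.card_le_card (Finset.image_mono _ (Finset.subset_univ _))
      _ ≤ k := Finset.card_image_le.trans_eq (Finset.card_fin k)
  · have hcard (a : Fin ℓ) := card_filter_eq_sum_colorCount c τ a fun j => y j = y (τ i₀)
    exact (hcard a).trans (by rw [h a b, hcard b])

theorem IsFairClustering.exists_assignment {C : Fin n → EuclideanSpace ℝ (Fin d)}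
    (hC : IsFairClustering k c C) :
    ∃ τ : Fin n → Fin k, (∀ i i', τ i = τ i' ↔ C i = C i') ∧
      ∀ a b, colorCount c τ a = colorCount c τ b := by
  classical
  obtain ⟨hcard, hbalanced⟩ := hC
  let τ : Fin n → Fin k := fun i => Fin.castLE hcard
    ((Finset.univ.image C).equivFin ⟨C i, Finset.mem_image_of_mem C (Finset.mem_univ i)⟩)
  have hτ (i i' : Fin n) : τ i = τ i' ↔ C i = C i' := by
    simp only [τ, (Fin.castLE_injective hcard).eq_iff, Equiv.apply_eq_iff_eq, Subtype.mk.injEq]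
  refine ⟨τ, hτ, fun a b => funext fun j => Fin.ext ?_⟩
  simp only [colorCount]
  by_cases hj : ∃ i, τ i = j
  · obtain ⟨i, rfl⟩ := hj
    simpa only [Finset.filter_filter, hτ, and_comm] using hbalanced i a b
  · have hempty (a : Fin ℓ) : (Finset.univ.filter fun i => c i = a ∧ τ i = j) = ∅ :=
      Finset.filter_eq_empty_iff.2 fun i _ h => hj ⟨i, h.2⟩
    rw [hempty, hempty]

theorem IsFairClustering.card_colors_le [Nonempty (Fin n)] {C : Fin n → EuclideanSpace ℝ (Fin d)}
    (hC : IsFairClustering k c C) : ℓ ≤ n := by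
  classical
  have hsurj : Function.Surjective c := by
    let i : Fin n := Classical.arbitrary _
    refine fun a => ?_
    by_contra! hne
    have h := hC.2 i a (c i)
    rw [Finset.card_eq_zero.2 (Finset.filter_eq_empty_iff.2 fun i _ => hne i), eq_comm,
      Finset.card_eq_zero, Finset.filter_eq_empty_iff] at h
    exact h (Finset.mem_filter.2 ⟨Finset.mem_univ i, rfl⟩) rfl
  simpa only [Fintype.card_fin] using Fintype.card_le_of_surjective c hsurj

theorem isFairClustering_of_subsingleton [Subsingleton (Fin n)] (hk : 1 ≤ k)
    {C : Fin n → EuclideanSpace ℝ (Fin d)} (hbalanced : Balanced c Finset.univ) :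
    IsFairClustering k c C := by
  classical
  refine ⟨Finset.card_image_le.trans ((Finset.card_le_one_of_subsingleton _).trans hk),
    fun j => ?_⟩
  simpa only [Subsingleton.elim _ j, Finset.filter_true] using hbalanced

end

/-! ### Guesses -/

/-- A clustering problem as a program finds it in its memory: `n` points in dimension `d` with `ℓ`
colours, where coordinate `e` of the point `i` is `coord (i * d + e)`, together with the number `m`
of points that are sampled for each of the `k` centers. -/
structure Instance where
  obj : Objective
  (n d ℓ k m : ℕ)
  color : ℕ → ℕ
  coord : ℕ → ℝ

namespace Instance

variable (I : Instance)

/-- The number of possible codes of an assignment of a colour class. -/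
def numCodes : ℕ := (I.n + 1) ^ I.k

/-- A guess is a code of the assignment of a colour class, together with `m` points for each
center. -/
def numGuesses : ℕ := I.n ^ (I.k * I.m) * I.numCodes

/-- The code that belongs to the guess `x`, which all colour classes have to attain. -/
def guessCode (x : ℕ) : ℕ := x % I.numCodes

/-- The sampled points that belong to the guess `x`; those for the center `j` have the indices
`j * m, …, j * m + m - 1`. -/
def guessSample (x u : ℕ) : ℕ := x / I.numCodes / I.n ^ u % I.n

/-- Coordinate `e` of the center `j` that belongs to the guess `x`. -/
noncomputable def meanCoord (x j e : ℕ) : ℝ :=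
  (∑ t ∈ Finset.range I.m, I.coord (I.guessSample x (j * I.m + t) * I.d + e)) / I.m

/-- The cost of assigning the point `i` to the center `j` that belongs to the guess `x`. -/
noncomputable def pointWeight (x i j : ℕ) : ℝ :=
  I.obj.weight (∑ e ∈ Finset.range I.d, (I.coord (i * I.d + e) - I.meanCoord x j e) ^ 2)

/-- The cost of an assignment to the centers that belong to the guess `x`. -/
noncomputable def guessCost (x : ℕ) (τ : ℕ → ℕ) : ℝ :=
  I.obj.total (fun i => I.pointWeight x i (τ i)) I.n

/-- The problem of assigning the points of colour `a` to the centers that belong to the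
guess `x`. -/
noncomputable def classProblem (x a : ℕ) : ClassProblem where
  obj := I.obj
  n := I.n
  k := I.k
  numCodes := I.numCodes
  color := I.color
  cls := a
  digit j := (I.n + 1) ^ j
  weight := I.pointWeight x

/-- An assignment in which all colour classes have the code that belongs to the guess `x`. -/
structure IsValid (x : ℕ) (τ : ℕ → ℕ) : Prop where
  center_lt : ∀ i < I.n, τ i < I.k
  code_eq : ∀ a < I.ℓ, (I.classProblem x a).code τ I.n = I.guessCode x

/-- A cheapest valid assignment for the guess `x`. -/
structure IsBest (x : ℕ) (σ : ℕ → ℕ) : Prop where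
  valid : I.IsValid x σ
  cost_le : ∀ τ, I.IsValid x τ → I.guessCost x σ ≤ I.guessCost x τ

/-- The array `out` holds the centers of the points in the valid assignment `σ` for the guess `x`,
whose cost is `best`. -/
structure IsOutput (x : ℕ) (σ : ℕ → ℕ) (out : ℕ → ℝ) (best : ℝ) : Prop where
  valid : I.IsValid x σ
  out_eq : ∀ i < I.n, ∀ e < I.d, out (i * I.d + e) = I.meanCoord x (σ i) e
  cost_eq : best = I.guessCost x σ

/-- The state of the search through the guesses after the guesses below `N`, where `found` is a flag
that tells whether a valid assignment has been found. -/
def SearchState (N found : ℕ) (out : ℕ → ℝ) (best : ℝ) : Prop :=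
  (found = 0 ∧ ∀ x < N, ∀ τ, ¬ I.IsValid x τ) ∨
  (found = 1 ∧ (∃ x σ, I.IsOutput x σ out best) ∧
    ∀ x < N, ∀ τ, I.IsValid x τ → best ≤ I.guessCost x τ)

variable {I} {N x found : ℕ} {σ : ℕ → ℕ} {out out' : ℕ → ℝ} {best best' : ℝ}

theorem numCodes_pos : 0 < I.numCodes := Nat.pow_pos I.n.succ_pos

theorem guessCode_lt (x : ℕ) : I.guessCode x < I.numCodes := Nat.mod_lt x numCodes_pos

theorem pointWeight_nonneg (x i j : ℕ) : 0 ≤ I.pointWeight x i j :=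
  I.obj.weight_nonneg (Finset.sum_nonneg fun _ _ => sq_nonneg _)

theorem isBest_of_isOptimal (hcolor : ∀ i < I.n, I.color i < I.ℓ)
    (h : ∀ a < I.ℓ, (I.classProblem x a).IsOptimal (I.guessCode x) σ) : I.IsBest x σ where
  valid := ⟨fun i hi => (h _ (hcolor i hi)).center_lt i hi rfl, fun a ha => (h a ha).code_eq⟩
  cost_le τ hτ := I.obj.total_le_total_of_classes hcolor (fun i _ => pointWeight_nonneg x i (τ i))
    fun a ha => (h a ha).cost_le τ hτ.center_lt (hτ.code_eq a ha)

theorem SearchState.init (out : ℕ → ℝ) (best : ℝ) : I.SearchState 0 0 out best :=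
  .inl ⟨rfl, fun _ hx => absurd hx (Nat.not_lt_zero _)⟩

theorem SearchState.keep (h : I.SearchState N found out best)
    (hN : ∀ τ, I.IsValid N τ → found ≠ 0 ∧ best ≤ I.guessCost N τ) :
    I.SearchState (N + 1) found out best := by
  rcases h with ⟨h₀, hnone⟩ | ⟨h₁, hout, hle⟩
  · exact .inl ⟨h₀, Nat.forall_lt_succ_right.2 ⟨hnone, fun τ hτ => (hN τ hτ).1 h₀⟩⟩
  · exact .inr ⟨h₁, hout, Nat.forall_lt_succ_right.2 ⟨hle, fun τ hτ => (hN τ hτ).2⟩⟩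

theorem SearchState.replace (h : I.SearchState N found out best) (hσ : I.IsBest N σ)
    (hout : I.IsOutput N σ out' best') (hlt : found ≠ 0 → best' < best) :
    I.SearchState (N + 1) 1 out' best' := by
  refine .inr ⟨rfl, ⟨N, σ, hout⟩, Nat.forall_lt_succ_right.2 ⟨fun x hx τ hτ => ?_, fun τ hτ => ?_⟩⟩
  · rcases h with ⟨-, hnone⟩ | ⟨rfl, -, hle⟩
    · exact absurd hτ (hnone x hx τ)
    · exact (hlt one_ne_zero).le.trans (hle x hx τ hτ)
  · exact hout.cost_eq.trans_le (hσ.cost_le τ hτ)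

theorem exists_guess {r : ℕ} (hr : r < I.numCodes) {g : ℕ → ℕ → ℕ} (hg : ∀ j t, g j t < I.n) :
    ∃ x < I.numGuesses, I.guessCode x = r ∧
      ∀ j < I.k, ∀ t < I.m, I.guessSample x (j * I.m + t) = g j t := by
  let y := finFunctionFinEquiv fun u : Fin (I.k * I.m) =>
    (⟨g (u / I.m) (u % I.m), hg _ _⟩ : Fin I.n)
  refine ⟨y * I.numCodes + r, cell_lt y.2 hr, Nat.mul_add_mod_of_lt hr, fun j hj t ht => ?_⟩
  have hu := cell_lt hj ht
  calc I.guessSample (y * I.numCodes + r) (j * I.m + t)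
      = finFunctionFinEquiv.symm y ⟨j * I.m + t, hu⟩ := by rw [guessSample, cell_div hr]; rfl
    _ = g j t := by
      rw [Equiv.symm_apply_apply]
      simp only [cell_div ht, Nat.mul_add_mod_of_lt ht]

end Instance

section

variable {n d ℓ : ℕ} (A : Fin n → EuclideanSpace ℝ (Fin d)) (c : Fin n → Fin ℓ) (k : ℕ) (ε : ℝ)

theorem inputMemory_real_one (i : Fin n) (e : Fin d) :
    (inputMemory A c k ε).real 1 (i * d + e) = A i e := by
  have hdiv : (i * d + e : ℕ) / d = i := cell_div e.2
  have hmod : (i * d + e : ℕ) % d = e := Nat.mul_add_mod_of_lt e.2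
  simp [inputMemory, hdiv, hmod]

theorem inputMemory_nat_one (i : Fin n) : (inputMemory A c k ε).nat 1 i = c i := by
  simp [inputMemory]

/-- The clustering problem given by the input of the program. -/
noncomputable def Instance.ofInput (obj : Objective) (A : Fin n → EuclideanSpace ℝ (Fin d))
    (c : Fin n → Fin ℓ) (k : ℕ) (ε : ℝ) : Instance where
  obj := obj
  n := n
  d := d
  ℓ := ℓ
  k := k
  m := sampleSize ε
  color := (inputMemory A c k ε).nat 1
  coord := (inputMemory A c k ε).real 1

namespace Instance

/-- The center `j` that belongs to the guess `x`. -/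
noncomputable def meanCenter (obj : Objective) (A : Fin n → EuclideanSpace ℝ (Fin d))
    (c : Fin n → Fin ℓ) (k : ℕ) (ε : ℝ) (x j : ℕ) : EuclideanSpace ℝ (Fin d) :=
  WithLp.toLp 2 fun e => (ofInput obj A c k ε).meanCoord x j e

variable {A c k ε} {obj : Objective}

theorem color_ofInput_lt : ∀ i < n, (ofInput obj A c k ε).color i < ℓ := fun i hi =>
  (inputMemory_nat_one A c k ε ⟨i, hi⟩).trans_lt (c ⟨i, hi⟩).2

theorem code_ofInput (x : ℕ) {τ : Fin n → Fin k} {σ : ℕ → ℕ} (hσ : ∀ i : Fin n, σ i = τ i)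
    (a : Fin ℓ) :
    ((ofInput obj A c k ε).classProblem x a).code σ n = finFunctionFinEquiv (colorCount c τ a) :=
  classCode_eq_finFunctionFinEquiv c (inputMemory_nat_one A c k ε) τ hσ a

theorem guessCost_ofInput (x : ℕ) (τ : ℕ → ℕ) :
    (ofInput obj A c k ε).guessCost x τ =
      obj.cost A fun i => meanCenter obj A c k ε x (τ i) := by
  refine obj.total_eq_cost _ _ fun i => ?_
  refine congrArg obj.weight ?_
  rw [EuclideanSpace.real_norm_sq_eq, Finset.sum_range]
  exact Finset.sum_congr rfl fun e _ =>
    congrArg (fun u => (u - _) ^ 2) (inputMemory_real_one A c k ε i e)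

theorem meanCenter_eq_sampleMean {x j : ℕ} {g : ℕ → Fin n}
    (h : ∀ t < sampleSize ε,
      (ofInput obj A c k ε).guessSample x (j * sampleSize ε + t) = g t) :
    meanCenter obj A c k ε x j = sampleMean A (sampleSize ε) g := by
  ext e
  simp only [meanCenter, meanCoord, sampleMean, PiLp.smul_apply, smul_eq_mul, WithLp.ofLp_sum,
    Finset.sum_apply, div_eq_inv_mul]
  refine congrArg _ (Finset.sum_congr rfl fun t ht => ?_)
  rw [← inputMemory_real_one A c k ε, ← h t (Finset.mem_range.1 ht)]
  rfl

theorem IsValid.isFairClustering {x : ℕ} {σ : ℕ → ℕ} (h : (ofInput obj A c k ε).IsValid x σ)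
    (y : ℕ → EuclideanSpace ℝ (Fin d)) : IsFairClustering k c fun i => y (σ i) := by
  let τ : Fin n → Fin k := fun i => ⟨σ i, h.center_lt i i.2⟩
  have hcode (a : Fin ℓ) :
      (finFunctionFinEquiv (colorCount c τ a) : ℕ) = (ofInput obj A c k ε).guessCode x :=
    (code_ofInput x (fun _ => rfl) a).symm.trans (h.code_eq a a.2)
  exact isFairClustering_of_colorCount_eq
    (fun a b => finFunctionFinEquiv.injective (Fin.ext ((hcode a).trans (hcode b).symm)))
    fun j : Fin k => y j

end Instance

open Instance

variable {A c k ε} (obj : Objective)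

theorem IsFairClustering.exists_isValid [Nonempty (Fin n)] {C : Fin n → EuclideanSpace ℝ (Fin d)}
    (hC : IsFairClustering k c C) (hε : 0 < ε) :
    ∃ x < (ofInput obj A c k ε).numGuesses, ∃ τ, (ofInput obj A c k ε).IsValid x τ ∧
      (ofInput obj A c k ε).guessCost x τ ≤ (1 + ε) * obj.cost A C := by
  obtain ⟨τ, hτ, hcount⟩ := hC.exists_assignment
  obtain ⟨y, rfl⟩ := (Function.factorsThrough_iff C).1 fun i i' => (hτ i i').1
  obtain ⟨g, hg⟩ := obj.exists_cost_sampleMean_le A τ y hε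
  let i₀ : Fin n := Classical.arbitrary _
  obtain ⟨x, hx, hcode, hsample⟩ := exists_guess (I := ofInput obj A c k ε)
    (finFunctionFinEquiv (colorCount c τ (c i₀))).2
    (g := fun j t => if hj : j < k then g ⟨j, hj⟩ t else i₀) fun j t => by
      split_ifs <;> exact Fin.is_lt _
  let σ : ℕ → ℕ := fun i => if h : i < n then τ ⟨i, h⟩ else 0
  have hσ (i : Fin n) : σ i = τ i := by simp only [σ, i.2, dif_pos]
  refine ⟨x, hx, σ, ⟨fun i hi => ?_, fun a ha => ?_⟩, le_of_eq_of_le ?_ hg⟩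
  · exact (hσ ⟨i, hi⟩).trans_lt (τ ⟨i, hi⟩).2
  · rw [hcode, hcount (c i₀) ⟨a, ha⟩]
    exact code_ofInput x hσ ⟨a, ha⟩
  · rw [guessCost_ofInput]
    congr 1
    funext i
    rw [hσ]
    refine meanCenter_eq_sampleMean fun t ht => ?_
    rw [show sampleSize ε = (ofInput obj A c k ε).m from rfl, hsample _ (τ i).2 t ht,
      dif_pos (τ i).2]

variable {obj}

theorem Instance.SearchState.isFairClustering_and_cost_le [Nonempty (Fin n)] {found : ℕ}
    {s : Memory} {best : ℝ}
    (h : (ofInput obj A c k ε).SearchState (ofInput obj A c k ε).numGuesses found (s.real 2) best)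
    (hε : 0 < ε) {C : Fin n → EuclideanSpace ℝ (Fin d)} (hC : IsFairClustering k c C) :
    IsFairClustering k c (outputMatrix n d s) ∧
      obj.cost A (outputMatrix n d s) ≤ (1 + ε) * obj.cost A C := by
  obtain ⟨x, hx, τ, hτ, hcost⟩ := hC.exists_isValid (A := A) obj hε
  rcases h with ⟨-, hnone⟩ | ⟨-, ⟨y, σ, hσ⟩, hmin⟩
  · exact absurd hτ (hnone x hx τ)
  have hout : outputMatrix n d s = fun i : Fin n => meanCenter obj A c k ε y (σ i) := by
    ext i e
    exact hσ.out_eq i i.2 e e.2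
  rw [hout]
  refine ⟨hσ.valid.isFairClustering _, ?_⟩
  rw [← guessCost_ofInput, ← hσ.cost_eq]
  exact (hmin x hx τ hτ).trans hcost

end

/-! ### Memory access -/

@[simp] theorem Memory.setNat_real (s : Memory) (a i v : ℕ) : (s.setNat a i v).real = s.real := rfl

@[simp] theorem Memory.setReal_nat (s : Memory) (a i : ℕ) (v : ℝ) :
    (s.setReal a i v).nat = s.nat := rfl

@[simp] theorem Memory.setNat_nat (s : Memory) (a i v b j : ℕ) :
    (s.setNat a i v).nat b j = if b = a ∧ j = i then v else s.nat b j := by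
  by_cases hb : b = a
  · subst hb
    by_cases hj : j = i <;> simp [setNat, hj]
  · simp [setNat, hb]

@[simp] theorem Memory.setReal_real (s : Memory) (a i b j : ℕ) (v : ℝ) :
    (s.setReal a i v).real b j = if b = a ∧ j = i then v else s.real b j := by
  by_cases hb : b = a
  · subst hb
    by_cases hj : j = i <;> simp [setReal, hj]
  · simp [setReal, hb]

theorem Memory.setNat_nat_self (s : Memory) (a i v : ℕ) :
    (s.setNat a i v).nat a = Function.update (s.nat a) i v :=
  Function.update_self ..

theorem Memory.setNat_nat_of_ne (s : Memory) {a b : ℕ} (h : b ≠ a) (i v : ℕ) :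
    (s.setNat a i v).nat b = s.nat b :=
  Function.update_of_ne h _ _

theorem Memory.setReal_real_of_ne (s : Memory) {a b : ℕ} (h : b ≠ a) (i : ℕ) (v : ℝ) :
    (s.setReal a i v).real b = s.real b :=
  Function.update_of_ne h _ _

attribute [simp] NatExpr.eval RealExpr.eval BoolExpr.Holds

/-! ### Static cost of programs -/

/-- The comparisons that bound a loop by the dimension, which is the cell `1` of the integer
array `0`. -/
def BoolExpr.isDimBound : BoolExpr → Bool
  | .natLT _ (.get 0 (.const 1)) => true
  | _ => false

/-- The admissible number of rounds of a loop with the condition `b`: at most `D` if it is bounded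
by the dimension, and at most `Y` otherwise. -/
def BoolExpr.rounds (b : BoolExpr) (Y D : ℕ) : ℕ := if b.isDimBound then D else Y

namespace Program

/-- A bound for the number of steps of a program all of whose loops take an admissible number of
rounds. -/
def cost (Y D : ℕ) : Program → ℕ
  | .skip => 1
  | .setNat _ i e => i.steps + e.steps + 1
  | .setReal _ i e => i.steps + e.steps + 1
  | .seq P Q => P.cost Y D + Q.cost Y D
  | .ite b P Q => b.steps + 1 + (P.cost Y D + Q.cost Y D)
  | .while b P => b.steps + 1 + b.rounds Y D * (b.steps + 1 + P.cost Y D)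

/-- The part of the bound for the number of steps that does not depend on the input. -/
def coeff : Program → ℕ
  | .skip => 1
  | .setNat _ i e => i.steps + e.steps + 1
  | .setReal _ i e => i.steps + e.steps + 1
  | .seq P Q => P.coeff + Q.coeff
  | .ite b P Q => b.steps + 1 + (P.coeff + Q.coeff)
  | .while b P => b.steps + 1 + (b.steps + 1 + P.coeff)

/-- Nesting depth of the loops that are not bounded by the dimension. -/
def depth : Program → ℕ
  | .skip => 0
  | .setNat _ _ _ => 0
  | .setReal _ _ _ => 0
  | .seq P Q => max P.depth Q.depth
  | .ite _ P Q => max P.depth Q.depth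
  | .while b P => if b.isDimBound then P.depth else P.depth + 1

/-- Nesting depth of the loops that are bounded by the dimension. -/
def dimDepth : Program → ℕ
  | .skip => 0
  | .setNat _ _ _ => 0
  | .setReal _ _ _ => 0
  | .seq P Q => max P.dimDepth Q.dimDepth
  | .ite _ P Q => max P.dimDepth Q.dimDepth
  | .while b P => if b.isDimBound then P.dimDepth + 1 else P.dimDepth

/-- The part of the bound for the number of steps that depends on the input. The factor `D + 1`
replaces `D`, which may be `0`. -/
def growth (Y D : ℕ) (P : Program) : ℕ := (D + 1) ^ P.dimDepth * Y ^ P.depth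

variable {Y : ℕ} (D : ℕ) {P Q : Program}

theorem one_le_growth (hY : 1 ≤ Y) : 1 ≤ P.growth Y D :=
  Nat.mul_pos (Nat.pow_pos D.succ_pos) (Nat.pow_pos hY)

theorem growth_mono (hY : 1 ≤ Y) (hdim : P.dimDepth ≤ Q.dimDepth) (hdepth : P.depth ≤ Q.depth) :
    P.growth Y D ≤ Q.growth Y D :=
  Nat.mul_le_mul (Nat.pow_le_pow_right D.succ_pos hdim) (Nat.pow_le_pow_right hY hdepth)

theorem rounds_mul_growth_le (b : BoolExpr) :
    b.rounds Y D * P.growth Y D ≤ growth Y D (.while b P) := by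
  cases hb : b.isDimBound <;> simp only [BoolExpr.rounds, growth, depth, dimDepth, hb,
    Bool.false_eq_true, if_false, if_true]
  · exact le_of_eq (by ring)
  · calc D * ((D + 1) ^ P.dimDepth * Y ^ P.depth)
        ≤ (D + 1) * ((D + 1) ^ P.dimDepth * Y ^ P.depth) :=
          Nat.mul_le_mul_right _ (Nat.le_succ D)
      _ = (D + 1) ^ (P.dimDepth + 1) * Y ^ P.depth := by ring

theorem cost_le (hY : 1 ≤ Y) (P : Program) : P.cost Y D ≤ P.coeff * P.growth Y D := by
  have const_le (a : ℕ) (P : Program) : a ≤ a * P.growth Y D :=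
    Nat.le_mul_of_pos_right a (one_le_growth D hY)
  induction P with
  | skip => exact const_le _ _
  | setNat => exact const_le _ _
  | setReal => exact const_le _ _
  | seq P Q hP hQ =>
    rw [cost, coeff, add_mul]
    exact add_le_add
      (hP.trans (Nat.mul_le_mul_left _ (growth_mono D hY (le_max_left _ _) (le_max_left _ _))))
      (hQ.trans (Nat.mul_le_mul_left _ (growth_mono D hY (le_max_right _ _) (le_max_right _ _))))
  | ite b P Q hP hQ =>
    rw [cost, coeff, add_mul _ (_ + _), add_mul P.coeff]
    exact add_le_add (const_le _ _) (add_le_add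
      (hP.trans (Nat.mul_le_mul_left _ (growth_mono D hY (le_max_left _ _) (le_max_left _ _))))
      (hQ.trans (Nat.mul_le_mul_left _ (growth_mono D hY (le_max_right _ _) (le_max_right _ _)))))
  | _ b P hP =>
    rw [cost, coeff, add_mul _ (_ + _)]
    refine add_le_add (const_le _ _) ?_
    calc b.rounds Y D * (b.steps + 1 + P.cost Y D)
        ≤ b.rounds Y D * ((b.steps + 1 + P.coeff) * P.growth Y D) := by
          rw [add_mul _ P.coeff]
          exact Nat.mul_le_mul_left _ (add_le_add (const_le _ _) hP)
      _ = (b.steps + 1 + P.coeff) * (b.rounds Y D * P.growth Y D) := mul_left_comm _ _ _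
      _ ≤ _ := Nat.mul_le_mul_left _ (rounds_mul_growth_le D b)

end Program

/-! ### Frames -/

/-- Whether a program assigns to cells of the integer array `a`. -/
def Program.writesNat (a : ℕ) : Program → Bool
  | .skip => false
  | .setNat b _ _ => a == b
  | .setReal _ _ _ => false
  | .seq P Q => P.writesNat a || Q.writesNat a
  | .ite _ P Q => P.writesNat a || Q.writesNat a
  | .while _ P => P.writesNat a

/-- Whether a program assigns to cells of the real array `a`. -/
def Program.writesReal (a : ℕ) : Program → Bool
  | .skip => false
  | .setNat _ _ _ => false
  | .setReal b _ _ => a == b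
  | .seq P Q => P.writesReal a || Q.writesReal a
  | .ite _ P Q => P.writesReal a || Q.writesReal a
  | .while _ P => P.writesReal a

/-- The memories `s` and `s'` agree on all arrays to which the program does not assign. The
conditions on `writesNat` and `writesReal` are discharged by evaluation for concrete programs. -/
structure Frame (P : Program) (s s' : Memory) : Prop where
  nat : ∀ a, (ha : P.writesNat a = false := by rfl) → s'.nat a = s.nat a
  real : ∀ a, (ha : P.writesReal a = false := by rfl) → s'.real a = s.real a

section

variable {P P' Q : Program} {s s' s'' : Memory} {t : ℕ}

theorem Frame.refl (P : Program) (s : Memory) : Frame P s s := ⟨fun _ _ => rfl, fun _ _ => rfl⟩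

theorem Frame.trans (h : Frame P s s') (h' : Frame P s' s'') : Frame P s s'' :=
  ⟨fun a ha => (h'.nat a ha).trans (h.nat a ha), fun a ha => (h'.real a ha).trans (h.real a ha)⟩

theorem Frame.weaken (h : Frame P s s') (hnat : ∀ a, P'.writesNat a = false → P.writesNat a = false)
    (hreal : ∀ a, P'.writesReal a = false → P.writesReal a = false) : Frame P' s s' :=
  ⟨fun a ha => h.nat a (hnat a ha), fun a ha => h.real a (hreal a ha)⟩

theorem Frame.setNat (s : Memory) (a : ℕ) (i e : NatExpr) (j v : ℕ) :
    Frame (.setNat a i e) s (s.setNat a j v) :=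
  ⟨fun _ hb => s.setNat_nat_of_ne (beq_eq_false_iff_ne.1 hb) j v, fun _ _ => rfl⟩

theorem Frame.setReal (s : Memory) (a : ℕ) (i : NatExpr) (e : RealExpr) (j : ℕ) (v : ℝ) :
    Frame (.setReal a i e) s (s.setReal a j v) :=
  ⟨fun _ _ => rfl, fun _ hb => s.setReal_real_of_ne (beq_eq_false_iff_ne.1 hb) j v⟩

theorem Frame.seq_left (h : Frame P s s') : Frame (.seq P Q) s s' :=
  h.weaken (fun _ ha => (Bool.or_eq_false_iff.1 ha).1) fun _ ha => (Bool.or_eq_false_iff.1 ha).1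

theorem Frame.seq_right (h : Frame Q s s') : Frame (.seq P Q) s s' :=
  h.weaken (fun _ ha => (Bool.or_eq_false_iff.1 ha).2) fun _ ha => (Bool.or_eq_false_iff.1 ha).2

theorem Exec.frame (h : Exec P s s' t) : Frame P s s' := by
  induction h with
  | skip => exact .refl _ _
  | setNat s a i e => exact .setNat s a i e _ _
  | setReal s a i e => exact .setReal s a i e _ _
  | seq _ _ h h' => exact h.seq_left.trans h'.seq_right
  | iteTrue _ _ h => exact h.seq_left.weaken (fun _ => id) fun _ => id
  | iteFalse _ _ h => exact h.seq_right.weaken (fun _ => id) fun _ => id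
  | whileFalse => exact .refl _ _
  | whileTrue _ _ _ h h' =>
    exact .trans (P := .while _ _) (h.weaken (fun _ => id) fun _ => id) h'

end

/-! ### Total correctness within the static cost -/

/-- Started with memory `s`, the program `P` halts within `P.cost Y D` steps, and then `Q` holds. -/
def Runs (Y D : ℕ) (P : Program) (s : Memory) (Q : Memory → Prop) : Prop :=
  ∃ s' t, Exec P s s' t ∧ t ≤ P.cost Y D ∧ Q s'

/-- The scalar integer variable stored in the cell `0` of the array `a`. -/
abbrev NatExpr.var (a : ℕ) : NatExpr := .get a (.const 0)

/-- The scalar real variable stored in the cell `0` of the array `a`. -/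
abbrev RealExpr.var (a : ℕ) : RealExpr := .get a (.const 0)

/-- Assignment to a scalar integer variable. -/
abbrev Program.letNat (a : ℕ) (e : NatExpr) : Program := .setNat a (.const 0) e

/-- Assignment to a scalar real variable. -/
abbrev Program.letReal (a : ℕ) (e : RealExpr) : Program := .setReal a (.const 0) e

/-- The condition of a loop with the counter `v` and the bound in the cell `i` of the integer
array `a`. -/
def BoolExpr.counterLT (v a i : ℕ) : BoolExpr := .natLT (.var v) (.get a (.const i))

/-- `for v = 0, …, b - 1 do P`, where the bound `b` is the cell `i` of the integer array `a`. -/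
def Program.forLoop (v a i : ℕ) (P : Program) : Program :=
  .seq (.letNat v (.const 0))
    (.while (.counterLT v a i) (.seq P (.letNat v (.add (.var v) (.const 1)))))

namespace Runs

variable {Y D : ℕ} {P P' : Program} {s : Memory} {Q Q' : Memory → Prop}

theorem mono (h : Runs Y D P s Q) (hQ : ∀ s', Frame P s s' → Q s' → Q' s') : Runs Y D P s Q' := by
  obtain ⟨s', t, he, ht, hs⟩ := h
  exact ⟨s', t, he, ht, hQ s' he.frame hs⟩

theorem skip (h : Q s) : Runs Y D .skip s Q := ⟨s, 1, .skip s, le_rfl, h⟩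

theorem setNat {a : ℕ} {i e : NatExpr} (h : Q (s.setNat a (i.eval s) (e.eval s))) :
    Runs Y D (.setNat a i e) s Q := ⟨_, _, .setNat s a i e, le_rfl, h⟩

theorem setReal {a : ℕ} {i : NatExpr} {e : RealExpr}
    (h : Q (s.setReal a (i.eval s) (e.eval s))) :
    Runs Y D (.setReal a i e) s Q := ⟨_, _, .setReal s a i e, le_rfl, h⟩

theorem seq (h : Runs Y D P s fun s' => Runs Y D P' s' Q) : Runs Y D (.seq P P') s Q := by
  obtain ⟨s', t, he, ht, s'', t', he', ht', hs⟩ := h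
  exact ⟨s'', t + t', he.seq he', add_le_add ht ht', hs⟩

theorem comp {R : Memory → Prop} (h : Runs Y D P s R)
    (h' : ∀ s', Frame P s s' → R s' → Runs Y D P' s' Q) : Runs Y D (.seq P P') s Q :=
  .seq (h.mono h')

theorem ite {b : BoolExpr} (h : b.Holds s → Runs Y D P s Q) (h' : ¬ b.Holds s → Runs Y D P' s Q) :
    Runs Y D (.ite b P P') s Q := by
  by_cases hb : b.Holds s
  · obtain ⟨s', t, he, ht, hs⟩ := h hb
    exact ⟨s', _, .iteTrue hb he, by rw [Program.cost]; omega, hs⟩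
  · obtain ⟨s', t, he, ht, hs⟩ := h' hb
    exact ⟨s', _, .iteFalse hb he, by rw [Program.cost]; omega, hs⟩

theorem whileLoop {b : BoolExpr} {N : ℕ} (Inv : ℕ → Memory → Prop) (hN : N ≤ b.rounds Y D)
    (h₀ : Inv 0 s) (hstep : ∀ i < N, ∀ s, Inv i s → b.Holds s ∧ Runs Y D P s (Inv (i + 1)))
    (hend : ∀ s, Inv N s → ¬ b.Holds s) : Runs Y D (.while b P) s (Inv N) := by
  have remaining_rounds (j : ℕ) : ∀ i s, i + j = N → Inv i s → ∃ s' t, Exec (.while b P) s s' t ∧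
      t ≤ b.steps + 1 + j * (b.steps + 1 + P.cost Y D) ∧ Inv N s' := by
    induction j with
    | zero =>
      rintro i s rfl hs
      exact ⟨s, _, .whileFalse (hend s hs), by omega, hs⟩
    | succ j ih =>
      intro i s hi hs
      obtain ⟨hb, s', t, he, ht, hs'⟩ := hstep i (by omega) s hs
      obtain ⟨s'', t', he', ht', hs''⟩ := ih (i + 1) s' (by omega) hs'
      refine ⟨s'', _, .whileTrue hb he he', ?_, hs''⟩
      rw [add_mul]
      omega
  obtain ⟨s', t, he, ht, hs⟩ := remaining_rounds N 0 s (zero_add N) h₀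
  exact ⟨s', t, he, ht.trans (Nat.add_le_add_left (Nat.mul_le_mul_right _ hN) _), hs⟩

theorem forLoop {v a i N : ℕ} (Inv : ℕ → Memory → Prop) (hbound : s.nat a i = N)
    (hN : N ≤ (BoolExpr.counterLT v a i).rounds Y D) (h₀ : Inv 0 (s.setNat v 0 0))
    (hstep : ∀ j < N, ∀ s', Frame (.forLoop v a i P) s s' → s'.nat v 0 = j → Inv j s' →
      Runs Y D P s' fun s'' => Inv (j + 1) (s''.setNat v 0 (j + 1)))
    (hv : P.writesNat v = false := by rfl)
    (ha : (Program.forLoop v a i P).writesNat a = false := by rfl) :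
    Runs Y D (.forLoop v a i P) s (Inv N) := by
  refine .seq (.setNat ?_)
  refine (whileLoop (fun j s' => Frame (.forLoop v a i P) s s' ∧ s'.nat v 0 = j ∧ Inv j s')
    hN ⟨(Frame.setNat ..).seq_left, by simp, h₀⟩ ?_ ?_).mono fun s' _ h => h.2.2
  · rintro j hj s' ⟨hF, rfl, hI⟩
    refine ⟨?_, .seq ((hstep _ hj s' hF rfl hI).mono fun s'' hF' hI' => .setNat ?_)⟩
    · simpa [BoolExpr.counterLT, hF.nat a ha, hbound] using hj
    have hcounter : s''.nat v 0 = s'.nat v 0 := by rw [hF'.nat v hv]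
    refine ⟨?_, by simp [hcounter], by simpa [hcounter] using hI'⟩
    refine hF.trans (Frame.trans (s' := s'') ?_ (Frame.setNat ..).seq_left)
    exact Frame.seq_right (hF'.seq_left.weaken (fun _ => id) fun _ => id)
  · rintro s' ⟨hF, hvj, -⟩
    simp [BoolExpr.counterLT, hvj, hF.nat a ha, hbound]

end Runs

/-! ### Registers -/

namespace Param

@[simp] abbrev n : ℕ := 0
@[simp] abbrev d : ℕ := 1
@[simp] abbrev ℓ : ℕ := 2
@[simp] abbrev k : ℕ := 3

end Param

namespace Reg

@[simp] abbrev params : ℕ := 0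
@[simp] abbrev colors : ℕ := 1
@[simp] abbrev sampleSize : ℕ := 2
@[simp] abbrev powers : ℕ := 3
@[simp] abbrev numCodes : ℕ := 4
@[simp] abbrev numGuesses : ℕ := 5
@[simp] abbrev numSamples : ℕ := 6
@[simp] abbrev numWeights : ℕ := 7
@[simp] abbrev tableSize : ℕ := 8
@[simp] abbrev guess : ℕ := 9
@[simp] abbrev quotient : ℕ := 10
@[simp] abbrev remainder : ℕ := 11
@[simp] abbrev code : ℕ := 12
@[simp] abbrev digits : ℕ := 13
@[simp] abbrev digitIndex : ℕ := 14
@[simp] abbrev samples : ℕ := 15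
@[simp] abbrev center : ℕ := 16
@[simp] abbrev coordIndex : ℕ := 17
@[simp] abbrev sampleIndex : ℕ := 18
@[simp] abbrev cell : ℕ := 19
@[simp] abbrev candidate : ℕ := 20
@[simp] abbrev cls : ℕ := 21
@[simp] abbrev minimizers : ℕ := 22
@[simp] abbrev restCode : ℕ := 23
@[simp] abbrev assignment : ℕ := 24
@[simp] abbrev feasible : ℕ := 25
@[simp] abbrev traceStep : ℕ := 26
@[simp] abbrev tracePoint : ℕ := 27
@[simp] abbrev totalPoint : ℕ := 28
@[simp] abbrev found : ℕ := 29
@[simp] abbrev outPoint : ℕ := 30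

end Reg

namespace RealReg

@[simp] abbrev ε : ℕ := 0
@[simp] abbrev coords : ℕ := 1
@[simp] abbrev out : ℕ := 2
@[simp] abbrev mean : ℕ := 3
@[simp] abbrev weights : ℕ := 4
@[simp] abbrev sqDist : ℕ := 5
@[simp] abbrev table : ℕ := 6
@[simp] abbrev cost : ℕ := 7
@[simp] abbrev bestCost : ℕ := 8

end RealReg

/-- A number that is part of the input; see `Param`. -/
abbrev NatExpr.param (i : ℕ) : NatExpr := .get Reg.params (.const i)

/-- Bounds for the numbers of rounds of the loops of the program, except for those that are bounded
by the dimension. -/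
structure LoopBounds (I : Instance) (Y : ℕ) : Prop where
  one_le_n : 1 ≤ I.n
  one_le_k : 1 ≤ I.k
  numColors_le : I.ℓ ≤ I.n
  numSamples_le : I.k * I.m ≤ Y
  numGuesses_le : I.numGuesses ≤ Y
  tableSize_le : I.n * I.numCodes ≤ Y

/-- The memory holds the input and the numbers that are computed once before the search. -/
structure Ready (I : Instance) (s : Memory) : Prop where
  n_eq : s.nat Reg.params Param.n = I.n
  d_eq : s.nat Reg.params Param.d = I.d
  numColors_eq : s.nat Reg.params Param.ℓ = I.ℓ
  k_eq : s.nat Reg.params Param.k = I.k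
  color_eq : s.nat Reg.colors = I.color
  coord_eq : s.real RealReg.coords = I.coord
  m_eq : s.nat Reg.sampleSize 0 = I.m
  powers_eq : ∀ j < I.k, s.nat Reg.powers j = (I.n + 1) ^ j
  numCodes_eq : s.nat Reg.numCodes 0 = I.numCodes
  numGuesses_eq : s.nat Reg.numGuesses 0 = I.numGuesses
  numSamples_eq : s.nat Reg.numSamples 0 = I.k * I.m
  numWeights_eq : s.nat Reg.numWeights 0 = I.n * I.k
  tableSize_eq : s.nat Reg.tableSize 0 = I.n * I.numCodes

/-- Moreover, the memory holds the code and the samples that belong to the guess `x`. -/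
structure Decoded (I : Instance) (x : ℕ) (s : Memory) : Prop extends Ready I s where
  code_eq : s.nat Reg.code 0 = I.guessCode x
  samples_eq : ∀ u < I.k * I.m, s.nat Reg.samples u = I.guessSample x u

/-- The program does not assign to the arrays that `Ready` is about. -/
def Program.keepsReady (P : Program) : Bool :=
  (List.range 9).all (fun a => !P.writesNat a) && !P.writesReal RealReg.coords

/-- The program does not assign to the arrays that `Decoded` is about. -/
def Program.keepsDecoded (P : Program) : Bool :=
  P.keepsReady && !P.writesNat Reg.code && !P.writesNat Reg.samples

section

variable {I : Instance} {Y x : ℕ} {s s' : Memory} {P : Program}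

theorem LoopBounds.n_le (hb : LoopBounds I Y) : I.n ≤ Y :=
  (Nat.le_mul_of_pos_right _ Instance.numCodes_pos).trans hb.tableSize_le

theorem LoopBounds.numCodes_le (hb : LoopBounds I Y) : I.numCodes ≤ Y :=
  (Nat.le_mul_of_pos_left _ hb.one_le_n).trans hb.tableSize_le

theorem LoopBounds.numWeights_le (hb : LoopBounds I Y) : I.n * I.k ≤ Y :=
  (Nat.mul_le_mul_left _ (Nat.lt_pow_self (Nat.lt_add_of_pos_left hb.one_le_n)).le).trans
    hb.tableSize_le

theorem LoopBounds.k_le (hb : LoopBounds I Y) : I.k ≤ Y :=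
  (Nat.le_mul_of_pos_left _ hb.one_le_n).trans hb.numWeights_le

theorem LoopBounds.m_le (hb : LoopBounds I Y) : I.m ≤ Y :=
  (Nat.le_mul_of_pos_left _ hb.one_le_k).trans hb.numSamples_le

theorem Ready.congr (h : Ready I s) (hnat : ∀ a < 9, s'.nat a = s.nat a)
    (hreal : s'.real RealReg.coords = s.real RealReg.coords) : Ready I s' := by
  have cell_eq (a i : ℕ) (ha : a < 9 := by decide) : s'.nat a i = s.nat a i :=
    congrFun (hnat a ha) i
  exact
  { n_eq := (cell_eq ..).trans h.n_eq
    d_eq := (cell_eq ..).trans h.d_eq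
    numColors_eq := (cell_eq ..).trans h.numColors_eq
    k_eq := (cell_eq ..).trans h.k_eq
    color_eq := (hnat _ (by decide)).trans h.color_eq
    coord_eq := hreal.trans h.coord_eq
    m_eq := (cell_eq ..).trans h.m_eq
    powers_eq := fun j hj => (cell_eq ..).trans (h.powers_eq j hj)
    numCodes_eq := (cell_eq ..).trans h.numCodes_eq
    numGuesses_eq := (cell_eq ..).trans h.numGuesses_eq
    numSamples_eq := (cell_eq ..).trans h.numSamples_eq
    numWeights_eq := (cell_eq ..).trans h.numWeights_eq
    tableSize_eq := (cell_eq ..).trans h.tableSize_eq }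

theorem Ready.frame (h : Ready I s) (hF : Frame P s s') (hP : P.keepsReady = true := by rfl) :
    Ready I s' := by
  simp only [Program.keepsReady, Bool.and_eq_true, List.all_eq_true, List.mem_range,
    Bool.not_eq_true'] at hP
  exact h.congr (fun a ha => hF.nat a (hP.1 a ha)) (hF.real _ hP.2)

theorem Ready.setNat (h : Ready I s) {a : ℕ} (i v : ℕ) (ha : 9 ≤ a := by decide) :
    Ready I (s.setNat a i v) :=
  h.congr (fun _ hb => s.setNat_nat_of_ne (hb.trans_le ha).ne i v) rfl

theorem Ready.setReal (h : Ready I s) {a : ℕ} (i : ℕ) (v : ℝ) (ha : 2 ≤ a := by decide) :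
    Ready I (s.setReal a i v) :=
  h.congr (fun _ _ => rfl) (s.setReal_real_of_ne (Nat.lt_of_succ_le ha).ne i v)

theorem Decoded.frame (h : Decoded I x s) (hF : Frame P s s')
    (hP : P.keepsDecoded = true := by rfl) : Decoded I x s' := by
  simp only [Program.keepsDecoded, Bool.and_eq_true, Bool.not_eq_true'] at hP
  refine ⟨h.toReady.frame hF hP.1.1, ?_, fun u hu => ?_⟩
  · rw [hF.nat _ hP.1.2, h.code_eq]
  · rw [hF.nat _ hP.2, h.samples_eq u hu]

theorem Decoded.setNat (h : Decoded I x s) {a : ℕ} (i v : ℕ) (ha : 16 ≤ a := by decide) :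
    Decoded I x (s.setNat a i v) := by
  refine ⟨h.toReady.setNat i v (le_trans (by decide) ha), ?_, fun u hu => ?_⟩
  · rw [s.setNat_nat_of_ne (lt_of_lt_of_le (by decide) ha).ne, h.code_eq]
  · rw [s.setNat_nat_of_ne (lt_of_lt_of_le (by decide) ha).ne, h.samples_eq u hu]

theorem Decoded.setReal (h : Decoded I x s) {a : ℕ} (i : ℕ) (v : ℝ) (ha : 2 ≤ a := by decide) :
    Decoded I x (s.setReal a i v) :=
  ⟨h.toReady.setReal i v ha, h.code_eq, h.samples_eq⟩

end

/-! ### Decoding of a guess -/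

/-- Division of `p` by the cell `i` of the integer array `a`, with remainder. -/
def divMod (p : NatExpr) (a i : ℕ) : Program :=
  .seq (.letNat Reg.remainder p) <| .seq (.letNat Reg.quotient (.const 0)) <|
    .while (.not (.natLT (.var Reg.remainder) (.get a (.const i)))) <|
      .seq (.letNat Reg.remainder (.sub (.var Reg.remainder) (.get a (.const i))))
        (.letNat Reg.quotient (.add (.var Reg.quotient) (.const 1)))

/-- Converts the guess into the code of the colour classes and the sampled points. -/
def decodeProg : Program :=
  .seq (divMod (.var Reg.guess) Reg.numCodes 0) <|
    .seq (.letNat Reg.code (.var Reg.remainder)) <|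
      .seq (.letNat Reg.digits (.var Reg.quotient)) <|
        .forLoop Reg.digitIndex Reg.numSamples 0 <|
          .seq (divMod (.var Reg.digits) Reg.params Param.n) <|
            .seq (.setNat Reg.samples (.var Reg.digitIndex) (.var Reg.remainder))
              (.letNat Reg.digits (.var Reg.quotient))

section

variable {I : Instance} {Y D x : ℕ} {s : Memory}

theorem runs_divMod {p : NatExpr} {a i u v : ℕ} (hp : p.eval s = u) (hq : s.nat a i = v)
    (hv : 1 ≤ v) (hu : u ≤ Y) (ha : (divMod p a i).writesNat a = false := by rfl) :
    Runs Y D (divMod p a i) s fun s' =>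
      s'.nat Reg.quotient 0 = u / v ∧ s'.nat Reg.remainder 0 = u % v := by
  have hmod : u - u / v * v = u % v := by rw [Nat.mod_eq_sub, mul_comm]
  have ha' : a ≠ Reg.remainder ∧ a ≠ Reg.quotient := by
    constructor <;> rintro rfl <;> simp [divMod, Program.writesNat] at ha
  refine .seq (.setNat (.seq (.setNat ?_)))
  refine (Runs.whileLoop (N := u / v) (fun j s' => s'.nat a i = v ∧
    s'.nat Reg.quotient 0 = j ∧ s'.nat Reg.remainder 0 = u - j * v) ?_ ?_ ?_ ?_).mono ?_
  · exact (Nat.div_le_self u v).trans hu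
  · simp [ha', hp, hq]
  · rintro j hj s' ⟨hs, hquo, hrem⟩
    have hle : j * v + v ≤ u := (Nat.succ_mul j v).symm.trans_le ((Nat.le_div_iff_mul_le hv).1 hj)
    refine ⟨?_, .seq (.setNat (.setNat ?_))⟩
    · simp only [BoolExpr.Holds, NatExpr.eval, hs, hrem]
      omega
    · simp [ha', hs, hquo, hrem, Nat.succ_mul, Nat.sub_sub]
  · rintro s' ⟨hs, -, hrem⟩
    simpa [hs, hrem, hmod] using Nat.mod_lt u hv
  · rintro s' - ⟨-, hquo, hrem⟩
    exact ⟨hquo, hrem.trans hmod⟩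

theorem runs_decodeProg (hb : LoopBounds I Y) (h : Ready I s) (hx : s.nat Reg.guess 0 = x)
    (hxY : x ≤ Y) : Runs Y D decodeProg s (Decoded I x) := by
  refine .comp (runs_divMod hx h.numCodes_eq Instance.numCodes_pos hxY)
    fun s₁ hF₁ ⟨hquo, hrem⟩ => .seq (.setNat (.seq (.setNat ?_)))
  have h₁ : Ready I ((s₁.setNat Reg.code 0 (s₁.nat Reg.remainder 0)).setNat Reg.digits 0
      (s₁.nat Reg.quotient 0)) := ((h.frame hF₁).setNat ..).setNat ..
  refine (Runs.forLoop (fun u s' => s'.nat Reg.code 0 = I.guessCode x ∧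
      s'.nat Reg.digits 0 = x / I.numCodes / I.n ^ u ∧
      ∀ u' < u, s'.nat Reg.samples u' = I.guessSample x u')
    h₁.numSamples_eq hb.numSamples_le ?_ ?_).mono fun s' hF ⟨hcode, _, hsamples⟩ =>
      ⟨h₁.frame hF, hcode, hsamples⟩
  · simp [hquo, hrem, Instance.guessCode]
  · rintro u - s₂ hF₂ hu ⟨hcode, hdigits, hsamples⟩
    have hle : x / I.numCodes / I.n ^ u ≤ Y :=
      (Nat.div_le_self _ _).trans ((Nat.div_le_self _ _).trans hxY)
    refine .comp (runs_divMod hdigits (h₁.frame hF₂).n_eq hb.one_le_n hle)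
      fun s₃ hF₃ ⟨hquo, hrem⟩ => .seq (.setNat (.setNat ⟨?_, ?_, ?_⟩))
    · simp [hF₃.nat Reg.code, hcode]
    · simp [hquo, pow_succ, Nat.div_div_eq_div_mul, mul_assoc]
    · refine Nat.forall_lt_succ_right.2 ⟨fun u' hu' => ?_, ?_⟩
      · simp [hF₃.nat Reg.samples, hF₃.nat Reg.digitIndex, hu, hu'.ne, hsamples u' hu']
      · simp [hF₃.nat Reg.digitIndex, hu, hrem, Instance.guessSample]

end

/-! ### Costs of the points -/

/-- Computes the coordinate `coordIndex` of the center `center`. -/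
def meanProg : Program :=
  .seq (.letReal RealReg.mean (.cast (.const 0))) <|
    .seq
      (.forLoop Reg.sampleIndex Reg.sampleSize 0 <|
        .letReal RealReg.mean <| .add (.var RealReg.mean) <| .get RealReg.coords <|
          .add (.mul (.get Reg.samples (.add (.mul (.var Reg.center) (.var Reg.sampleSize))
            (.var Reg.sampleIndex))) (.param Param.d)) (.var Reg.coordIndex))
      (.letReal RealReg.mean (.div (.var RealReg.mean) (.cast (.var Reg.sampleSize))))

/-- The difference of the coordinates `coordIndex` of the point `quotient` and the center. -/
def coordDiffE : RealExpr :=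
  .sub
    (.get RealReg.coords (.add (.mul (.var Reg.quotient) (.param Param.d)) (.var Reg.coordIndex)))
    (.var RealReg.mean)

/-- Computes the squared distance of the point `quotient` to the center `center`. -/
def sqDistProg : Program :=
  .seq (.letReal RealReg.sqDist (.cast (.const 0))) <|
    .forLoop Reg.coordIndex Reg.params Param.d <|
      .seq meanProg <|
        .letReal RealReg.sqDist (.add (.var RealReg.sqDist) (.mul coordDiffE coordDiffE))

/-- The cost of a point, as a function of its squared distance to the center. -/
def Objective.weightE (obj : Objective) (x : RealExpr) : RealExpr :=
  match obj with
  | .kMeans => x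
  | _ => .sqrt x

/-- Computes the costs of all assignments of a point to a center. -/
def weightProg (obj : Objective) : Program :=
  .forLoop Reg.cell Reg.numWeights 0 <|
    .seq (divMod (.var Reg.cell) Reg.params Param.k) <|
      .seq (.letNat Reg.center (.var Reg.remainder)) <|
        .seq sqDistProg <|
          .setReal RealReg.weights (.var Reg.cell) (obj.weightE (.var RealReg.sqDist))

@[simp] theorem Objective.eval_weightE (obj : Objective) (s : Memory) (x : RealExpr) :
    (obj.weightE x).eval s = obj.weight (x.eval s) := by
  cases obj <;> rfl

section

variable {I : Instance} {Y x j : ℕ} {s : Memory}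

theorem runs_meanProg (hb : LoopBounds I Y) (h : Decoded I x s) (hj : s.nat Reg.center 0 = j)
    (hjk : j < I.k) : Runs Y I.d meanProg s fun s' =>
      s'.real RealReg.mean 0 = I.meanCoord x j (s.nat Reg.coordIndex 0) := by
  refine .seq (.setReal (.comp (Runs.forLoop (fun t s' => s'.real RealReg.mean 0 =
    ∑ t' ∈ Finset.range t,
      I.coord (I.guessSample x (j * I.m + t') * I.d + s.nat Reg.coordIndex 0))
    h.m_eq hb.m_le ?_ ?_) fun s₁ hF₁ hsum => .setReal ?_))
  · simp
  · intro t ht s₁ hF₁ hv hsum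
    have hsample : s.nat Reg.samples (j * I.m + t) = I.guessSample x (j * I.m + t) :=
      h.samples_eq _ (cell_lt hjk ht)
    refine .setReal ?_
    simp [hF₁.nat Reg.sampleSize, hF₁.nat Reg.params, hF₁.nat Reg.samples, hF₁.nat Reg.center,
      hF₁.nat Reg.coordIndex, hF₁.real RealReg.coords, h.m_eq, h.d_eq, h.coord_eq, hv, hj, hsum,
      hsample, Finset.sum_range_succ]
  · simp [hsum, Instance.meanCoord, hF₁.nat Reg.sampleSize, h.m_eq]

theorem runs_sqDistProg (hb : LoopBounds I Y) (h : Decoded I x s) (hj : s.nat Reg.center 0 = j)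
    (hjk : j < I.k) : Runs Y I.d sqDistProg s fun s' =>
      s'.real RealReg.sqDist 0 = ∑ e ∈ Finset.range I.d,
        (I.coord (s.nat Reg.quotient 0 * I.d + e) - I.meanCoord x j e) ^ 2 := by
  refine .seq (.setReal (.forLoop (fun e s' => s'.real RealReg.sqDist 0 =
    ∑ e' ∈ Finset.range e,
      (I.coord (s.nat Reg.quotient 0 * I.d + e') - I.meanCoord x j e') ^ 2)
    h.d_eq le_rfl (by simp) fun e _ s₁ hF₁ hv hsum => ?_))
  have h₁ : Decoded I x s₁ := (h.setReal ..).frame hF₁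
  refine .comp (runs_meanProg hb h₁ ((congrFun (hF₁.nat Reg.center) 0).trans hj) hjk)
    fun s₂ hF₂ hmean => .setReal ?_
  simp [coordDiffE, hF₂.real RealReg.sqDist, hF₂.nat Reg.quotient, hF₁.nat Reg.quotient,
    hF₂.nat Reg.coordIndex, (h₁.frame hF₂).d_eq, (h₁.frame hF₂).coord_eq, hv, hmean, hsum,
    Finset.sum_range_succ, sq]

theorem runs_weightProg (hb : LoopBounds I Y) (h : Decoded I x s) :
    Runs Y I.d (weightProg I.obj) s fun s' => ∀ i < I.n, ∀ j < I.k,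
      s'.real RealReg.weights (i * I.k + j) = I.pointWeight x i j := by
  refine (Runs.forLoop (fun N s' => ∀ y < N,
    s'.real RealReg.weights y = I.pointWeight x (y / I.k) (y % I.k))
    h.numWeights_eq hb.numWeights_le (by simp) ?_).mono fun s' _ hw i hi j hj => ?_
  · intro y hy s₁ hF₁ hv hw
    have h₁ : Decoded I x s₁ := h.frame hF₁
    refine .comp (runs_divMod hv h₁.k_eq hb.one_le_k (hy.le.trans hb.numWeights_le))
      fun s₂ hF₂ ⟨hquo, hrem⟩ => .seq (.setNat ?_)
    refine .comp (runs_sqDistProg hb ((h₁.frame hF₂).setNat ..) (j := y % I.k) (by simpa using hrem)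
      (Nat.mod_lt y hb.one_le_k)) fun s₃ hF₃ hdist => .setReal ?_
    have hcell : s₃.nat Reg.cell 0 = y := by simp [hF₃.nat Reg.cell, hF₂.nat Reg.cell, hv]
    refine Nat.forall_lt_succ_right.2 ⟨fun y' hy' => ?_, ?_⟩
    · simp [hcell, hy'.ne, hF₃.real RealReg.weights, hF₂.real RealReg.weights, hw y' hy']
    · simp [hcell, hdist, hquo, Instance.pointWeight]
  · rw [hw _ (cell_lt hi hj), cell_div hj, Nat.mul_add_mod_of_lt hj]

end

/-! ### The table of the dynamic program -/

/-- Moreover, the memory holds the costs of the points that belong to the guess `x`. -/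
structure Weighted (I : Instance) (x : ℕ) (s : Memory) : Prop extends Decoded I x s where
  weights_eq : ∀ i < I.n, ∀ j < I.k, s.real RealReg.weights (i * I.k + j) = I.pointWeight x i j

/-- Moreover, the memory holds the cell `y` of the table, split into a point and a code. -/
structure AtCell (I : Instance) (x y : ℕ) (s : Memory) : Prop extends Weighted I x s where
  cell_eq : s.nat Reg.cell 0 = y
  quotient_eq : s.nat Reg.quotient 0 = y / I.numCodes
  remainder_eq : s.nat Reg.remainder 0 = y % I.numCodes

theorem Weighted.frame {I : Instance} {x : ℕ} {P : Program} {s s' : Memory} (h : Weighted I x s)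
    (hF : Frame P s s') (hP : P.keepsDecoded = true := by rfl)
    (hw : P.writesReal RealReg.weights = false := by rfl) : Weighted I x s' :=
  ⟨h.toDecoded.frame hF hP, fun i hi j hj =>
    (congrFun (hF.real _ hw) _).trans (h.weights_eq i hi j hj)⟩

theorem Weighted.setNat {I : Instance} {x : ℕ} {s : Memory} (h : Weighted I x s) {a : ℕ} (i v : ℕ)
    (ha : 16 ≤ a := by decide) : Weighted I x (s.setNat a i v) :=
  ⟨h.toDecoded.setNat i v ha, h.weights_eq⟩

theorem Weighted.setReal {I : Instance} {x : ℕ} {s : Memory} (h : Weighted I x s) {a : ℕ} (i : ℕ)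
    (v : ℝ) (ha : 5 ≤ a := by decide) : Weighted I x (s.setReal a i v) := by
  refine ⟨h.toDecoded.setReal i v (le_trans (by decide) ha), fun i' hi j hj => ?_⟩
  rw [s.setReal_real_of_ne (lt_of_lt_of_le (by decide) ha).ne, h.weights_eq i' hi j hj]

/-- The expression for the combination of two costs. The maximum is `(x + y + |x - y|) / 2`. -/
def Objective.opE (obj : Objective) (x y : RealExpr) : RealExpr :=
  match obj with
  | .kCenter => .div (.add (.add x y) (.sqrt (.mul (.sub x y) (.sub x y)))) (.cast (.const 2))
  | _ => .add x y

/-- Equality of integers. -/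
def BoolExpr.natEq (e f : NatExpr) : BoolExpr := .and (.not (.natLT e f)) (.not (.natLT f e))

/-- The real number `-1`. -/
def RealExpr.negOne : RealExpr := .sub (.cast (.const 0)) (.cast (.const 1))

/-- The cell in which the point of the current cell is assigned last. -/
abbrev NatExpr.target : NatExpr := .add (.var Reg.cell) (.var Reg.numCodes)

/-- The entry of the table from which the current candidate continues. -/
abbrev RealExpr.source : RealExpr :=
  .get RealReg.table (.sub (.var Reg.cell) (.get Reg.powers (.var Reg.candidate)))

/-- The expression for `ClassProblem.candidate`. -/
def candidateE (obj : Objective) : RealExpr :=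
  obj.opE .source (.get RealReg.weights
    (.add (.mul (.var Reg.quotient) (.param Param.k)) (.var Reg.candidate)))

/-- The condition that the current candidate is usable and improves the target cell. -/
def improvesE (obj : Objective) : BoolExpr :=
  .and
    (.and (.not (.natLT (.var Reg.remainder) (.get Reg.powers (.var Reg.candidate))))
      (.not (.realLT .source (.cast (.const 0)))))
    (.not (.and (.not (.realLT (.get RealReg.table .target) (.cast (.const 0))))
      (.not (.realLT (candidateE obj) (.get RealReg.table .target)))))

/-- Minimizes the target cell over all candidates. -/
def minimizeProg (obj : Objective) : Program :=
  .forLoop Reg.candidate Reg.params Param.k <|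
    .ite (improvesE obj)
      (.seq (.setReal RealReg.table .target (candidateE obj))
        (.setNat Reg.minimizers (.var Reg.cell) (.var Reg.candidate)))
      .skip

/-- Computes the target cell. -/
def fillProg (obj : Objective) : Program :=
  .seq (divMod (.var Reg.cell) Reg.numCodes 0) <|
    .ite (.natEq (.get Reg.colors (.var Reg.quotient)) (.var Reg.cls))
      (.seq (.setReal RealReg.table .target .negOne) (minimizeProg obj))
      (.setReal RealReg.table .target (.get RealReg.table (.var Reg.cell)))

/-- Computes the table for one colour class. -/
def tableProg (obj : Objective) : Program :=
  .seq
    (.forLoop Reg.cell Reg.numCodes 0 (.setReal RealReg.table (.var Reg.cell) .negOne)) <|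
    .seq (.letReal RealReg.table (.cast (.const 0))) <|
      .forLoop Reg.cell Reg.tableSize 0 (fillProg obj)

@[simp] theorem Objective.eval_opE (obj : Objective) (s : Memory) (x y : RealExpr) :
    (obj.opE x y).eval s = obj.op (x.eval s) (y.eval s) := by
  cases obj
  · rfl
  · rfl
  · simp only [opE, op, RealExpr.eval, NatExpr.eval, Real.sqrt_mul_self_eq_abs, Nat.cast_ofNat]
    rw [abs_sub_comm, div_eq_inv_mul]
    exact (sup_eq_half_smul_add_add_abs_sub' ℝ _ _).symm

@[simp] theorem BoolExpr.holds_natEq (s : Memory) (e f : NatExpr) :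
    (BoolExpr.natEq e f).Holds s ↔ e.eval s = f.eval s := by
  simp only [natEq, Holds]
  omega

@[simp] theorem RealExpr.eval_negOne (s : Memory) : RealExpr.negOne.eval s = -1 := by
  simp [negOne]

section

variable {I : Instance} {Y x y a j : ℕ} {s : Memory}

theorem AtCell.eval_candidateE (h : AtCell I x y s) (hy : y < I.n * I.numCodes)
    (hv : s.nat Reg.candidate 0 = j) (hj : j < I.k) (a : ℕ) :
    (candidateE I.obj).eval s = (I.classProblem x a).candidate (s.real RealReg.table) y j := by
  have hw := h.weights_eq (y / I.numCodes) (Nat.div_lt_of_lt_mul (by rwa [mul_comm])) j hj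
  have hpow := h.powers_eq j hj
  simp [candidateE, ClassProblem.candidate, Instance.classProblem, h.cell_eq, h.quotient_eq, h.k_eq,
    hv, hw, hpow]

theorem AtCell.holds_improvesE (h : AtCell I x y s) (hy : y < I.n * I.numCodes)
    (hv : s.nat Reg.candidate 0 = j) (hj : j < I.k) (a : ℕ) :
    (improvesE I.obj).Holds s ↔ (I.classProblem x a).Usable (s.real RealReg.table) y j ∧
      (s.real RealReg.table (y + I.numCodes) < 0 ∨
        (I.classProblem x a).candidate (s.real RealReg.table) y j <
          s.real RealReg.table (y + I.numCodes)) := by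
  have hpow := h.powers_eq j hj
  simp [improvesE, h.eval_candidateE hy hv hj a, ClassProblem.Usable, Instance.classProblem,
    h.cell_eq, h.remainder_eq, h.numCodes_eq, hv, hpow, or_iff_not_imp_left]

theorem runs_minimizeProg (hb : LoopBounds I Y) (h : AtCell I x y s) (hy : y < I.n * I.numCodes)
    (hneg : s.real RealReg.table (y + I.numCodes) < 0) (a : ℕ) :
    Runs Y I.d (minimizeProg I.obj) s fun s' =>
      (∀ z ≠ y + I.numCodes, s'.real RealReg.table z = s.real RealReg.table z) ∧
      (∀ z ≠ y, s'.nat Reg.minimizers z = s.nat Reg.minimizers z) ∧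
      (I.classProblem x a).CellCorrect (s'.real RealReg.table) (s'.nat Reg.minimizers) I.k y := by
  refine .forLoop (fun j s' =>
      (∀ z ≠ y + I.numCodes, s'.real RealReg.table z = s.real RealReg.table z) ∧
      (∀ z ≠ y, s'.nat Reg.minimizers z = s.nat Reg.minimizers z) ∧
      (I.classProblem x a).CellCorrect (s'.real RealReg.table) (s'.nat Reg.minimizers) j y)
    h.k_eq hb.k_le ⟨fun _ _ => rfl, by simp, .inl ⟨hneg, by simp⟩⟩ ?_
  rintro j hj s₁ hF hv ⟨htable, hmin, hcell⟩
  have h₁ : AtCell I x y s₁ := ⟨h.toWeighted.frame hF, (congrFun (hF.nat _) 0).trans h.cell_eq,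
    (congrFun (hF.nat _) 0).trans h.quotient_eq, (congrFun (hF.nat _) 0).trans h.remainder_eq⟩
  refine .ite (fun hc => .seq (.setReal (.setNat ?_))) (fun hc => .skip ?_)
  · rw [h₁.holds_improvesE hy hv hj a] at hc
    refine ⟨fun z hz => ?_, fun z hz => ?_, hcell.update Instance.numCodes_pos
      (Instance.pointWeight_nonneg ..) hc.1 hc.2 (fun z hz => ?_) ?_ ?_⟩
    · simp [h₁.cell_eq, h₁.numCodes_eq, hz, htable z hz]
    · simp [h₁.cell_eq, hz, hmin z hz]
    · replace hz : z ≠ y + I.numCodes := hz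
      simp [h₁.cell_eq, h₁.numCodes_eq, hz]
    · rw [← h₁.eval_candidateE hy hv hj a]
      simp [h₁.cell_eq, h₁.numCodes_eq, Instance.classProblem]
    · simp [h₁.cell_eq, hv]
  · rw [h₁.holds_improvesE hy hv hj a] at hc
    exact ⟨htable, by simpa using hmin, by
      simpa [Memory.setNat_nat_of_ne] using hcell.keep hc⟩

theorem runs_fillProg (hb : LoopBounds I Y) (h : Weighted I x s) (ha : s.nat Reg.cls 0 = a)
    (hv : s.nat Reg.cell 0 = y) (hy : y < I.n * I.numCodes)
    (hT : (I.classProblem x a).TableCorrect y (s.real RealReg.table) (s.nat Reg.minimizers)) :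
    Runs Y I.d (fillProg I.obj) s fun s' => (I.classProblem x a).TableCorrect (y + 1)
      (s'.real RealReg.table) (s'.nat Reg.minimizers) := by
  refine .comp (runs_divMod hv h.numCodes_eq Instance.numCodes_pos (hy.le.trans hb.tableSize_le))
    fun s₁ hF₁ ⟨hquo, hrem⟩ => ?_
  have h₁ : AtCell I x y s₁ := ⟨h.frame hF₁, (congrFun (hF₁.nat _) 0).trans hv, hquo, hrem⟩
  rw [← hF₁.real RealReg.table, ← hF₁.nat Reg.minimizers] at hT
  have hcond : (BoolExpr.natEq (.get Reg.colors (.var Reg.quotient)) (.var Reg.cls)).Holds s₁ ↔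
      I.color (y / I.numCodes) = a := by
    simp [hquo, h₁.color_eq, hF₁.nat Reg.cls, ha]
  refine .ite (fun hc => .seq (.setReal ?_)) (fun hc => .setReal ?_) <;> rw [hcond] at hc
  · refine (runs_minimizeProg hb
      ⟨h₁.toWeighted.setReal .., h₁.cell_eq, h₁.quotient_eq, h₁.remainder_eq⟩ hy ?_ a).mono
      fun s₂ _ ⟨htable, hmin, hcell⟩ => hT.succ Instance.numCodes_pos (fun z hz => ?_)
        (fun z hz => hmin z hz.ne) (fun hne => absurd hc hne) (fun _ => hcell)
    · simp [h₁.cell_eq, h₁.numCodes_eq]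
    · replace hz : z ≠ y + I.numCodes := hz.ne
      simp [htable z hz, h₁.cell_eq, h₁.numCodes_eq, hz]
  · refine hT.succ Instance.numCodes_pos (fun z hz => ?_) (fun _ _ => rfl) (fun _ => ?_)
      (fun heq => absurd heq hc)
    · replace hz : z ≠ y + I.numCodes := hz.ne
      simp [h₁.cell_eq, h₁.numCodes_eq, hz]
    · simp [h₁.cell_eq, h₁.numCodes_eq, Instance.classProblem]

theorem runs_tableProg (hb : LoopBounds I Y) (h : Weighted I x s) (ha : s.nat Reg.cls 0 = a) :
    Runs Y I.d (tableProg I.obj) s fun s' =>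
      (I.classProblem x a).TableCorrect (I.n * I.numCodes) (s'.real RealReg.table)
        (s'.nat Reg.minimizers) := by
  refine .comp (Runs.forLoop (fun N s' => ∀ r < N, s'.real RealReg.table r = -1) h.numCodes_eq
    hb.numCodes_le (by simp) fun N _ s' _ hv hneg => .setReal ?_) fun s₁ hF₁ hneg =>
      .seq (.setReal ?_)
  · refine Nat.forall_lt_succ_right.2 ⟨fun r hr => ?_, ?_⟩
    · simp [hv, hr.ne, hneg r hr]
    · simp [hv]
  · have h₁ : Weighted I x (s₁.setReal RealReg.table 0 (0 : ℕ)) := (h.frame hF₁).setReal ..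
    refine .forLoop (fun N s' => (I.classProblem x a).TableCorrect N (s'.real RealReg.table)
      (s'.nat Reg.minimizers)) h₁.tableSize_eq hb.tableSize_le ?_ fun y hy s₂ hF₂ hv hT => ?_
    · refine ⟨by simp, fun r hr₀ hr => ?_, by simp, by simp⟩
      simp [hr₀.ne', hneg r hr]
    · exact (runs_fillProg hb (h₁.frame hF₂) (by simp [hF₂.nat Reg.cls, hF₁.nat Reg.cls, ha]) hv hy
        hT).mono fun s₃ _ hT => hT

end

/-! ### Optimal assignments -/

/-- Assigns the point `tracePoint`, if it has the current colour. -/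
def traceStepProg : Program :=
  .ite (.natEq (.get Reg.colors (.var Reg.tracePoint)) (.var Reg.cls))
    (.seq
      (.setNat Reg.assignment (.var Reg.tracePoint) (.get Reg.minimizers
        (.add (.mul (.var Reg.tracePoint) (.var Reg.numCodes)) (.var Reg.restCode))))
      (.letNat Reg.restCode (.sub (.var Reg.restCode)
        (.get Reg.powers (.get Reg.assignment (.var Reg.tracePoint))))))
    .skip

/-- Reconstructs an optimal assignment of a colour class from the table. -/
def traceProg : Program :=
  .seq (.letNat Reg.restCode (.var Reg.code)) <|
    .forLoop Reg.traceStep Reg.params Param.n <|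
      .seq (.letNat Reg.tracePoint
        (.sub (.param Param.n) (.add (.var Reg.traceStep) (.const 1)))) traceStepProg

/-- Computes an optimal assignment of all colour classes, or sets `feasible` to `0`. -/
def classProg (obj : Objective) : Program :=
  .seq (.letNat Reg.feasible (.const 1)) <|
    .forLoop Reg.cls Reg.params Param.ℓ <|
      .seq (tableProg obj) <|
        .ite (.realLT (.get RealReg.table (.add (.var Reg.tableSize) (.var Reg.code)))
            (.cast (.const 0)))
          (.letNat Reg.feasible (.const 0)) traceProg

section

variable {I : Instance} {Y D x a i r : ℕ} {T : ℕ → ℝ} {s : Memory}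

theorem runs_traceStepProg (h : Decoded I x s) (ha : s.nat Reg.cls 0 = a)
    (hv : s.nat Reg.tracePoint 0 = i) (hi : i < I.n)
    (hT : (I.classProblem x a).TableCorrect (I.n * I.numCodes) T (s.nat Reg.minimizers))
    (ht : (I.classProblem x a).Traced T r (i + 1) (s.nat Reg.restCode 0) (s.nat Reg.assignment)) :
    Runs Y D traceStepProg s fun s' =>
      (I.classProblem x a).Traced T r i (s'.nat Reg.restCode 0) (s'.nat Reg.assignment) ∧
      ∀ i', I.color i' ≠ a → s'.nat Reg.assignment i' = s.nat Reg.assignment i' := by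
  have hcond : (BoolExpr.natEq (.get Reg.colors (.var Reg.tracePoint)) (.var Reg.cls)).Holds s ↔
      I.color i = a := by
    simp [h.color_eq, ha, hv]
  refine .ite (fun hc => .seq (.setNat (.setNat ?_))) (fun hc => .skip ?_) <;> rw [hcond] at hc
  · obtain ⟨j, hj⟩ : ∃ j, s.nat Reg.minimizers (i * I.numCodes + s.nat Reg.restCode 0) = j :=
      ⟨_, rfl⟩
    have hstep : (I.classProblem x a).Traced T r i (s.nat Reg.restCode 0 - (I.n + 1) ^ j)
        (Function.update (s.nat Reg.assignment) i j) := ht.step hT hi hc hj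
    have hcenter := hstep.center_lt i hi le_rfl hc
    rw [Function.update_self] at hcenter
    have hrest : (NatExpr.sub (.var Reg.restCode) (.get Reg.powers (.get Reg.assignment
        (.var Reg.tracePoint)))).eval (s.setNat Reg.assignment i j) =
          s.nat Reg.restCode 0 - (I.n + 1) ^ j := by
      simp [hv, h.powers_eq j hcenter]
    have hmin : (NatExpr.get Reg.minimizers (.add (.mul (.var Reg.tracePoint) (.var Reg.numCodes))
        (.var Reg.restCode))).eval s = j := by
      simp [hv, h.numCodes_eq, hj]
    have hpoint : (NatExpr.var Reg.tracePoint).eval s = i := hv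
    rw [hpoint, hmin, hrest, Memory.setNat_nat_of_ne (b := Reg.assignment) _ (by decide),
      s.setNat_nat_self Reg.assignment]
    refine ⟨by simpa using hstep, fun i' hi' => Function.update_of_ne ?_ _ _⟩
    rintro rfl
    exact hi' hc
  · exact ⟨ht.skip hT hi hc, fun _ _ => rfl⟩

theorem runs_traceProg (hb : LoopBounds I Y) (h : Decoded I x s) (ha : s.nat Reg.cls 0 = a)
    (hT : (I.classProblem x a).TableCorrect (I.n * I.numCodes) (s.real RealReg.table)
      (s.nat Reg.minimizers))
    (hnonneg : 0 ≤ s.real RealReg.table (I.n * I.numCodes + I.guessCode x)) :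
    Runs Y D traceProg s fun s' =>
      (I.classProblem x a).IsOptimal (I.guessCode x) (s'.nat Reg.assignment) ∧
      ∀ i, I.color i ≠ a → s'.nat Reg.assignment i = s.nat Reg.assignment i := by
  refine .seq (.setNat ?_)
  have h₀ : Decoded I x (s.setNat Reg.restCode 0 (s.nat Reg.code 0)) := h.setNat ..
  refine (Runs.forLoop (fun t s' =>
      (I.classProblem x a).Traced (s.real RealReg.table) (I.guessCode x) (I.n - t)
        (s'.nat Reg.restCode 0) (s'.nat Reg.assignment) ∧
      ∀ i, I.color i ≠ a → s'.nat Reg.assignment i = s.nat Reg.assignment i)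
    h₀.n_eq hb.n_le ⟨?_, fun _ _ => rfl⟩ ?_).mono fun s' _ ⟨htraced, hother⟩ => ⟨?_, hother⟩
  · rw [h.code_eq]
    exact .init (I.guessCode_lt x) hnonneg _
  · rintro t ht s₁ hF₁ hv ⟨htraced, hother⟩
    obtain ⟨i, hi, hin⟩ : ∃ i, I.n - t = i + 1 ∧ i < I.n := ⟨I.n - (t + 1), by omega, by omega⟩
    have hi' : I.n - (t + 1) = i := by omega
    have h₁ : Decoded I x s₁ := h₀.frame hF₁
    rw [hi] at htraced
    rw [hi']
    refine .seq (.setNat ?_)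
    refine (runs_traceStepProg (h₁.setNat ..) ?_ ?_ hin ?_ htraced).mono
      fun s₂ _ ⟨htraced, hother'⟩ => ⟨htraced, fun i' hi' => (hother' i' hi').trans (hother i' hi')⟩
    · simp [hF₁.nat Reg.cls, ha]
    · simp [h₁.n_eq, hv, hi']
    · rw [Memory.setNat_nat_of_ne _ (by decide), hF₁.nat Reg.minimizers]
      exact hT
  · rw [Nat.sub_self] at htraced
    exact htraced.isOptimal hT (I.guessCode_lt x)

theorem runs_classProg (hb : LoopBounds I Y) (hcolor : ∀ i < I.n, I.color i < I.ℓ)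
    (h : Weighted I x s) :
    Runs Y I.d (classProg I.obj) s fun s' =>
      (s'.nat Reg.feasible 0 = 0 ∧ ∀ τ, ¬ I.IsValid x τ) ∨
      (s'.nat Reg.feasible 0 = 1 ∧ I.IsBest x (s'.nat Reg.assignment)) := by
  refine .seq (.setNat ?_)
  have h₀ : Weighted I x (s.setNat Reg.feasible 0 1) := h.setNat ..
  refine (Runs.forLoop (fun a s' => (s'.nat Reg.feasible 0 = 0 ∧ ∀ τ, ¬ I.IsValid x τ) ∨
      (s'.nat Reg.feasible 0 = 1 ∧ ∀ b < a,
        (I.classProblem x b).IsOptimal (I.guessCode x) (s'.nat Reg.assignment)))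
    h₀.numColors_eq (hb.numColors_le.trans hb.n_le) (.inr (by simp)) ?_).mono fun s' _ hI =>
      hI.imp_right fun hI => ⟨hI.1, Instance.isBest_of_isOptimal hcolor hI.2⟩
  intro a ha s₁ hF₁ hv hI
  have h₁ : Weighted I x s₁ := h₀.frame hF₁
  refine .comp (runs_tableProg hb h₁ hv) fun s₂ hF₂ hT => ?_
  have h₂ : Decoded I x s₂ := (h₁.frame hF₂).toDecoded
  have hcond : (BoolExpr.realLT (.get RealReg.table (.add (.var Reg.tableSize) (.var Reg.code)))
      (.cast (.const 0))).Holds s₂ ↔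
        s₂.real RealReg.table (I.n * I.numCodes + I.guessCode x) < 0 := by
    simp [h₂.tableSize_eq, h₂.code_eq]
  refine .ite (fun hc => .setNat (.inl ⟨by simp, fun τ hτ => ?_⟩)) (fun hc => ?_) <;>
    rw [hcond] at hc
  · have hcode : (I.classProblem x a).code τ I.n = I.guessCode x := hτ.code_eq a ha
    have hle := hT.le_cost hτ.center_lt le_rfl (hcode.trans_lt (I.guessCode_lt x))
    exact hc.not_ge (hcode ▸ hle.1)
  · refine (runs_traceProg hb h₂ (by simp [hF₂.nat Reg.cls, hv]) hT (not_lt.1 hc)).mono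
      fun s₃ hF₃ ⟨hopt, hother⟩ => ?_
    rw [s₃.setNat_nat_of_ne (by decide), s₃.setNat_nat_of_ne (by decide), hF₃.nat Reg.feasible,
      hF₂.nat Reg.feasible]
    refine hI.imp_right fun hI => ⟨hI.1, Nat.forall_lt_succ_right.2 ⟨fun b hba => ?_, hopt⟩⟩
    refine (hI.2 b hba).congr fun i _ hi => ?_
    rw [hother i (hi.trans_lt hba).ne, hF₂.nat Reg.assignment]

end

/-! ### The search through all guesses -/

/-- Computes the cost of the current assignment. -/
def totalProg (obj : Objective) : Program :=
  .seq (.letReal RealReg.cost (.cast (.const 0))) <|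
    .forLoop Reg.totalPoint Reg.params Param.n <|
      .letReal RealReg.cost <| obj.opE (.var RealReg.cost) <| .get RealReg.weights <|
        .add (.mul (.var Reg.totalPoint) (.param Param.k))
          (.get Reg.assignment (.var Reg.totalPoint))

/-- Writes the center `center` to the row `outPoint` of the output. -/
def centerProg : Program :=
  .forLoop Reg.coordIndex Reg.params Param.d <|
    .seq meanProg <|
      .setReal RealReg.out
        (.add (.mul (.var Reg.outPoint) (.param Param.d)) (.var Reg.coordIndex))
        (.var RealReg.mean)

/-- Writes the centers of the current assignment to the output. -/
def outputProg : Program :=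
  .forLoop Reg.outPoint Reg.params Param.n <|
    .seq (.letNat Reg.center (.get Reg.assignment (.var Reg.outPoint))) centerProg

/-- The condition that there is a current assignment, which is cheaper than the best one so far. -/
def isBetterE : BoolExpr :=
  .and (.natLT (.const 0) (.var Reg.feasible))
    (.not (.and (.natLT (.const 0) (.var Reg.found))
      (.not (.realLT (.var RealReg.cost) (.var RealReg.bestCost)))))

/-- Replaces the output by the current assignment if that is cheaper. -/
def updateProg : Program :=
  .ite isBetterE
    (.seq (.letReal RealReg.bestCost (.var RealReg.cost)) <|
      .seq (.letNat Reg.found (.const 1)) outputProg)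
    .skip

/-- Tries all guesses. -/
def searchProg (obj : Objective) : Program :=
  .seq (.letNat Reg.found (.const 0)) <|
    .forLoop Reg.guess Reg.numGuesses 0 <|
      .seq decodeProg <| .seq (weightProg obj) <| .seq (classProg obj) <|
        .seq (totalProg obj) updateProg

section

variable {I : Instance} {Y x i j : ℕ} {s : Memory}

theorem runs_totalProg (hb : LoopBounds I Y) (h : Weighted I x s) :
    Runs Y I.d (totalProg I.obj) s fun s' => (∀ i < I.n, s.nat Reg.assignment i < I.k) →
      s'.real RealReg.cost 0 = I.guessCost x (s.nat Reg.assignment) := by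
  refine .seq (.setReal ?_)
  have h₀ : Weighted I x (s.setReal RealReg.cost 0 (0 : ℕ)) := h.setReal ..
  refine .forLoop (fun i s' => (∀ i < I.n, s.nat Reg.assignment i < I.k) →
    s'.real RealReg.cost 0 =
      I.obj.total (fun i => I.pointWeight x i (s.nat Reg.assignment i)) i) h₀.n_eq hb.n_le
    (by simp [Objective.total]) fun i hi s₁ hF hv hcost => .setReal fun hcenter => ?_
  have h₁ : Weighted I x s₁ := h₀.frame hF
  have hw := h₁.weights_eq i hi _ (hcenter i hi)
  simp [hcost hcenter, Objective.total, hv, h₁.k_eq, hF.nat Reg.assignment, hw]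

theorem runs_centerProg (hb : LoopBounds I Y) (h : Decoded I x s)
    (hi : s.nat Reg.outPoint 0 = i) (hj : s.nat Reg.center 0 = j) (hjk : j < I.k) :
    Runs Y I.d centerProg s fun s' =>
      (∀ y < i * I.d, s'.real RealReg.out y = s.real RealReg.out y) ∧
      ∀ e < I.d, s'.real RealReg.out (i * I.d + e) = I.meanCoord x j e := by
  refine .forLoop (fun N s' => (∀ y < i * I.d, s'.real RealReg.out y = s.real RealReg.out y) ∧
    ∀ e < N, s'.real RealReg.out (i * I.d + e) = I.meanCoord x j e) h.d_eq le_rfl (by simp) ?_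
  rintro e - s₁ hF₁ hv ⟨hrows, hrow⟩
  have h₁ : Decoded I x s₁ := h.frame hF₁
  refine .comp (runs_meanProg hb h₁ (by rw [hF₁.nat Reg.center, hj]) hjk) fun s₂ hF₂ hmean =>
    .setReal ?_
  have hcell : (NatExpr.add (.mul (.var Reg.outPoint) (.param Param.d))
      (.var Reg.coordIndex)).eval s₂ = i * I.d + e := by
    simp [hF₂.nat Reg.outPoint, hF₁.nat Reg.outPoint, hi, (h₁.frame hF₂).d_eq,
      hF₂.nat Reg.coordIndex, hv]
  rw [hcell, ← hF₂.real RealReg.out] at *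
  refine ⟨fun y hy => ?_, Nat.forall_lt_succ_right.2 ⟨fun e' he' => ?_, ?_⟩⟩
  · simp [hrows y hy, (Nat.lt_add_right e hy).ne]
  · simp [hrow e' he', he'.ne]
  · simp [hmean, hv]

theorem runs_outputProg (hb : LoopBounds I Y) (h : Decoded I x s)
    (hcenter : ∀ i < I.n, s.nat Reg.assignment i < I.k) :
    Runs Y I.d outputProg s fun s' => ∀ i < I.n, ∀ e < I.d,
      s'.real RealReg.out (i * I.d + e) = I.meanCoord x (s.nat Reg.assignment i) e := by
  refine .forLoop (fun N s' => ∀ i < N, ∀ e < I.d,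
    s'.real RealReg.out (i * I.d + e) = I.meanCoord x (s.nat Reg.assignment i) e)
    h.n_eq hb.n_le (by simp) fun i hi s₁ hF₁ hv hrows => .seq (.setNat ?_)
  refine (runs_centerProg hb ((h.frame hF₁).setNat ..) (i := i) ?_ ?_ (hcenter i hi)).mono
    fun s₂ _ ⟨hother, hrow⟩ => Nat.forall_lt_succ_right.2 ⟨fun i' hi' e he => ?_, hrow⟩
  · simp [hv]
  · simp [hv, hF₁.nat Reg.assignment]
  · exact (hother _ (cell_lt hi' he)).trans (hrows i' hi' e he)

theorem runs_updateProg (hb : LoopBounds I Y) (h : Decoded I x s)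
    (hbest : (s.nat Reg.feasible 0 = 0 ∧ ∀ τ, ¬ I.IsValid x τ) ∨
      (s.nat Reg.feasible 0 = 1 ∧ I.IsBest x (s.nat Reg.assignment) ∧
        s.real RealReg.cost 0 = I.guessCost x (s.nat Reg.assignment)))
    (hstate : I.SearchState x (s.nat Reg.found 0) (s.real RealReg.out)
      (s.real RealReg.bestCost 0)) :
    Runs Y I.d updateProg s fun s' => I.SearchState (x + 1) (s'.nat Reg.found 0)
      (s'.real RealReg.out) (s'.real RealReg.bestCost 0) := by
  have hcond : isBetterE.Holds s ↔ s.nat Reg.feasible 0 ≠ 0 ∧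
      (s.nat Reg.found 0 ≠ 0 → s.real RealReg.cost 0 < s.real RealReg.bestCost 0) := by
    simp [isBetterE, Nat.pos_iff_ne_zero]
  refine .ite (fun hc => .seq (.setReal (.seq (.setNat ?_)))) (fun hc => .skip ?_) <;>
    rw [hcond] at hc
  · obtain ⟨-, hσ, hcost⟩ := hbest.resolve_left fun h => hc.1 h.1
    have hcenter : ∀ i < I.n, s.nat Reg.assignment i < I.k := hσ.valid.center_lt
    have h₁ : Decoded I x ((s.setReal RealReg.bestCost 0 (s.real RealReg.cost 0)).setNat
        Reg.found 0 1) := (h.setReal ..).setNat ..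
    refine (runs_outputProg hb h₁ (by simpa using hcenter)).mono fun s' hF hout => ?_
    rw [hF.nat Reg.found, hF.real RealReg.bestCost]
    simpa using hstate.replace hσ ⟨hσ.valid, by simpa using hout, hcost⟩ hc.2
  · refine hstate.keep fun τ hτ => ?_
    obtain ⟨hfeasible, hσ, hcost⟩ := hbest.resolve_left fun h => h.2 τ hτ
    simp only [hfeasible, ne_eq, one_ne_zero, not_false_eq_true, true_and, Classical.not_imp,
      not_lt] at hc
    exact ⟨hc.1, hc.2.trans (hcost.trans_le (hσ.cost_le τ hτ))⟩

theorem runs_searchProg (hb : LoopBounds I Y) (hcolor : ∀ i < I.n, I.color i < I.ℓ)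
    (h : Ready I s) :
    Runs Y I.d (searchProg I.obj) s fun s' => I.SearchState I.numGuesses (s'.nat Reg.found 0)
      (s'.real RealReg.out) (s'.real RealReg.bestCost 0) := by
  refine .seq (.setNat ?_)
  have h₀ : Ready I (s.setNat Reg.found 0 0) := h.setNat ..
  refine .forLoop (fun x s' => I.SearchState x (s'.nat Reg.found 0) (s'.real RealReg.out)
    (s'.real RealReg.bestCost 0)) h₀.numGuesses_eq hb.numGuesses_le (by simpa using .init ..)
    fun x hx s₁ hF₁ hv hstate => ?_
  have h₁ : Ready I s₁ := h₀.frame hF₁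
  refine .comp (runs_decodeProg hb h₁ hv (hx.le.trans hb.numGuesses_le)) fun s₂ hF₂ h₂ => ?_
  refine .comp (runs_weightProg hb h₂) fun s₃ hF₃ hweights => ?_
  have h₃ : Weighted I x s₃ := ⟨h₂.frame hF₃, hweights⟩
  refine .comp (runs_classProg hb hcolor h₃) fun s₄ hF₄ hbest => ?_
  have h₄ : Weighted I x s₄ := h₃.frame hF₄
  refine .comp (runs_totalProg hb h₄) fun s₅ hF₅ hcost => ?_
  refine (runs_updateProg hb (h₄.frame hF₅).toDecoded ?_ ?_).mono fun s₆ _ hstate' => ?_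
  · rw [hF₅.nat Reg.feasible, hF₅.nat Reg.assignment]
    exact hbest.imp_right fun ⟨hfeasible, hσ⟩ => ⟨hfeasible, hσ, hcost hσ.valid.center_lt⟩
  · rwa [hF₅.nat Reg.found, hF₄.nat Reg.found, hF₃.nat Reg.found, hF₂.nat Reg.found,
      hF₅.real RealReg.out, hF₄.real RealReg.out, hF₃.real RealReg.out, hF₂.real RealReg.out,
      hF₅.real RealReg.bestCost, hF₄.real RealReg.bestCost, hF₃.real RealReg.bestCost,
      hF₂.real RealReg.bestCost]
  · simpa using hstate'

end

/-! ### The program -/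

/-- Computes the sample size. -/
def sizeProg : Program :=
  .seq (.letNat Reg.sampleSize (.const 0)) <|
    .while (.realLT (.mul (.cast (.var Reg.sampleSize)) (.mul (.var RealReg.ε) (.var RealReg.ε)))
        (.cast (.const 1)))
      (.letNat Reg.sampleSize (.add (.var Reg.sampleSize) (.const 1)))

/-- Computes the powers of `n + 1`. -/
def powProg : Program :=
  .seq (.setNat Reg.powers (.const 0) (.const 1)) <|
    .forLoop Reg.candidate Reg.params Param.k <|
      .setNat Reg.powers (.add (.var Reg.candidate) (.const 1)) <|
        .mul (.get Reg.powers (.var Reg.candidate)) (.add (.param Param.n) (.const 1))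

/-- Computes the bounds of the loops of a single guess. -/
def limitsProg : Program :=
  .seq (.letNat Reg.numCodes (.get Reg.powers (.param Param.k))) <|
    .seq (.letNat Reg.numSamples (.mul (.param Param.k) (.var Reg.sampleSize))) <|
      .seq (.letNat Reg.numWeights (.mul (.param Param.n) (.param Param.k)))
        (.letNat Reg.tableSize (.mul (.param Param.n) (.var Reg.numCodes)))

/-- Computes the number of guesses. -/
def numGuessesProg : Program :=
  .seq (.letNat Reg.numGuesses (.var Reg.numCodes)) <|
    .forLoop Reg.candidate Reg.numSamples 0 <|
      .letNat Reg.numGuesses (.mul (.param Param.n) (.var Reg.numGuesses))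

/-- Computes the sample size and the bounds of the loops. -/
def setupProg : Program :=
  .seq sizeProg <| .seq powProg <| .seq limitsProg numGuessesProg

/-- Copies the first point to the output. -/
def copyProg : Program :=
  .forLoop Reg.coordIndex Reg.params Param.d <|
    .setReal RealReg.out (.var Reg.coordIndex) (.get RealReg.coords (.var Reg.coordIndex))

/-- The approximation scheme. -/
def clusterProg (obj : Objective) : Program :=
  .ite (.natLT (.const 1) (.param Param.n))
    (.ite (.natLT (.param Param.n) (.param Param.ℓ)) .skip (.seq setupProg (searchProg obj)))
    copyProg

theorem growth_clusterProg (obj : Objective) (Y D : ℕ) :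
    (clusterProg obj).growth Y D = (D + 1) ^ 1 * Y ^ 4 := rfl

section

variable {Y D N k : ℕ} {s : Memory}

theorem runs_sizeProg {ε : ℝ} (hε : 0 < ε) (hs : s.real RealReg.ε 0 = ε) (hY : sampleSize ε ≤ Y) :
    Runs Y D sizeProg s fun s' => s'.nat Reg.sampleSize 0 = sampleSize ε := by
  have hpos : 0 < ε * ε := mul_pos hε hε
  refine .seq (.setNat ?_)
  refine (Runs.whileLoop (N := sampleSize ε) (fun i s' => s'.real RealReg.ε 0 = ε ∧
    s'.nat Reg.sampleSize 0 = i) ?_ (by simp [hs]) ?_ ?_).mono fun _ _ h => h.2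
  · exact hY
  · rintro i hi s' ⟨hε', rfl⟩
    refine ⟨?_, .setNat (by simp [hε'])⟩
    simpa [hε'] using (lt_div_iff₀ hpos).1 (Nat.lt_ceil.1 hi)
  · rintro s' ⟨hε', hsize⟩
    have hceil : 1 / (ε * ε) ≤ sampleSize ε := Nat.le_ceil _
    simpa [hε', hsize] using (div_le_iff₀ hpos).1 hceil

theorem runs_powProg (hn : s.nat Reg.params Param.n = N) (hk : s.nat Reg.params Param.k = k)
    (hY : k ≤ Y) :
    Runs Y D powProg s fun s' => ∀ j ≤ k, s'.nat Reg.powers j = (N + 1) ^ j := by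
  refine .seq (.setNat ?_)
  refine .forLoop (fun i s' => ∀ j ≤ i, s'.nat Reg.powers j = (N + 1) ^ j) (by simpa using hk) hY
    (by simp) fun i _ s' hF hv hpow => .setNat fun j hj => ?_
  rcases hj.lt_or_eq with hlt | rfl
  · simp [hv, hlt.ne, hpow j (Nat.lt_succ_iff.1 hlt)]
  · simp [hv, hpow i le_rfl, hF.nat Reg.params, hn, pow_succ]

theorem runs_limitsProg {m : ℕ} (hn : s.nat Reg.params Param.n = N)
    (hk : s.nat Reg.params Param.k = k) (hm : s.nat Reg.sampleSize 0 = m)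
    (hpow : s.nat Reg.powers k = (N + 1) ^ k) :
    Runs Y D limitsProg s fun s' => s'.nat Reg.numCodes 0 = (N + 1) ^ k ∧
      s'.nat Reg.numSamples 0 = k * m ∧ s'.nat Reg.numWeights 0 = N * k ∧
      s'.nat Reg.tableSize 0 = N * (N + 1) ^ k := by
  refine .seq (.setNat (.seq (.setNat (.seq (.setNat (.setNat ?_))))))
  simp [hn, hk, hm, hpow]

theorem runs_numGuessesProg {r : ℕ} (hn : s.nat Reg.params Param.n = N)
    (hr : s.nat Reg.numCodes 0 = r) (hk : s.nat Reg.numSamples 0 = k) (hY : k ≤ Y) :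
    Runs Y D numGuessesProg s fun s' => s'.nat Reg.numGuesses 0 = N ^ k * r := by
  refine .seq (.setNat ?_)
  refine .forLoop (fun i s' => s'.nat Reg.numGuesses 0 = N ^ i * r) (by simpa using hk) hY
    (by simp [hr]) fun i _ s' hF _ hguesses => .setNat ?_
  simp [hguesses, hF.nat Reg.params, hn, pow_succ', mul_assoc]

theorem runs_copyProg {d : ℕ} (hd : s.nat Reg.params Param.d = d) :
    Runs Y d copyProg s fun s' =>
      ∀ e < d, s'.real RealReg.out e = s.real RealReg.coords e := by
  refine .forLoop (fun N s' => ∀ e < N, s'.real RealReg.out e = s.real RealReg.coords e) hd le_rfl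
    (by simp) fun e _ s' hF hv hcopy =>
      .setReal (Nat.forall_lt_succ_right.2 ⟨fun e' he' => ?_, ?_⟩)
  · simp [hv, he'.ne, hcopy e' he']
  · simp [hv, hF.real RealReg.coords]

variable {n d ℓ : ℕ} {A : Fin n → EuclideanSpace ℝ (Fin d)} {c : Fin n → Fin ℓ} {ε : ℝ}
  {obj : Objective}

theorem runs_setupProg (hε : 0 < ε) (hb : LoopBounds (.ofInput obj A c k ε) Y) :
    Runs Y D setupProg (inputMemory A c k ε) (Ready (.ofInput obj A c k ε)) := by
  refine .comp (runs_sizeProg hε rfl hb.m_le) fun s₁ hF₁ hsize => ?_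
  have hparams₁ := congrFun (hF₁.nat Reg.params)
  refine .comp (runs_powProg (hparams₁ Param.n) (hparams₁ Param.k) hb.k_le) fun s₂ hF₂ hpow => ?_
  have hparams₂ (i : ℕ) := (congrFun (hF₂.nat Reg.params) i).trans (hparams₁ i)
  have hsize₂ := (congrFun (hF₂.nat Reg.sampleSize) 0).trans hsize
  refine .comp (runs_limitsProg (hparams₂ Param.n) (hparams₂ Param.k) hsize₂ (hpow k le_rfl))
    fun s₃ hF₃ ⟨hcodes, hsamples, hweights, htable⟩ => ?_
  have hparams₃ (i : ℕ) := (congrFun (hF₃.nat Reg.params) i).trans (hparams₂ i)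
  refine (runs_numGuessesProg (hparams₃ Param.n) hcodes hsamples hb.numSamples_le).mono
    fun s₄ hF₄ hguesses => ?_
  have hparams (i : ℕ) := (congrFun (hF₄.nat Reg.params) i).trans (hparams₃ i)
  exact
  { n_eq := hparams Param.n
    d_eq := hparams Param.d
    numColors_eq := hparams Param.ℓ
    k_eq := hparams Param.k
    color_eq := by
      rw [hF₄.nat Reg.colors, hF₃.nat Reg.colors, hF₂.nat Reg.colors, hF₁.nat Reg.colors]
      rfl
    coord_eq := by
      rw [hF₄.real RealReg.coords, hF₃.real RealReg.coords, hF₂.real RealReg.coords,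
        hF₁.real RealReg.coords]
      rfl
    m_eq := by rw [hF₄.nat Reg.sampleSize, hF₃.nat Reg.sampleSize, hsize₂]; rfl
    powers_eq := fun j hj => by
      rw [hF₄.nat Reg.powers, hF₃.nat Reg.powers, hpow j hj.le]
      rfl
    numCodes_eq := by rw [hF₄.nat Reg.numCodes, hcodes]; rfl
    numGuesses_eq := hguesses
    numSamples_eq := by rw [hF₄.nat Reg.numSamples, hsamples]; rfl
    numWeights_eq := by rw [hF₄.nat Reg.numWeights, hweights]; rfl
    tableSize_eq := by rw [hF₄.nat Reg.tableSize, htable]; rfl }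

theorem runs_clusterProg (hε : 0 < ε) (hk : 1 ≤ k) (hn : 1 ≤ n)
    (hb : 2 ≤ n → ℓ ≤ n → LoopBounds (.ofInput obj A c k ε) Y) :
    Runs Y d (clusterProg obj) (inputMemory A c k ε) fun s =>
      ∀ C, IsFairClustering k c C → IsFairClustering k c (outputMatrix n d s) ∧
        obj.cost A (outputMatrix n d s) ≤ (1 + ε) * obj.cost A C := by
  have : NeZero n := ⟨Nat.one_le_iff_ne_zero.1 hn⟩
  refine .ite (fun hn₂ => .ite (fun hℓ => .skip fun C hC => ?_) fun hℓ => ?_) (fun hn₂ => ?_)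
  · exact absurd hC.card_colors_le hℓ.not_ge
  · have hb := hb hn₂ (not_lt.1 hℓ)
    refine .comp (runs_setupProg hε hb) fun s₁ _ hready => ?_
    exact (runs_searchProg hb Instance.color_ofInput_lt hready).mono fun s₂ _ hstate C hC =>
      hstate.isFairClustering_and_cost_le hε hC
  · obtain rfl : n = 1 := le_antisymm (not_lt.1 hn₂) hn
    refine (runs_copyProg rfl).mono fun s₁ _ hcopy C hC => ?_
    have hout : outputMatrix 1 d s₁ = A := by
      ext i e
      rw [← inputMemory_real_one A c k ε i e, Subsingleton.elim i 0]
      simpa [outputMatrix] using hcopy e e.2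
    have hbalanced : Balanced c Finset.univ := by
      simpa [Subsingleton.elim _ (0 : Fin 1)] using hC.2 0
    rw [hout, obj.cost_self]
    exact ⟨isFairClustering_of_subsingleton hk hbalanced,
      mul_nonneg (by linarith) (obj.cost_nonneg A C)⟩

end

/-! ### Running time -/

theorem Instance.loopBounds {I : Instance} (hn : 2 ≤ I.n) (hk : 1 ≤ I.k) (hℓ : I.ℓ ≤ I.n) :
    LoopBounds I (I.n ^ (2 * I.k + I.k * I.m + 1)) := by
  have hcodes : I.numCodes ≤ I.n ^ (2 * I.k) := by
    rw [numCodes, pow_mul]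
    exact Nat.pow_le_pow_left (by nlinarith) I.k
  have hn₁ : 1 ≤ I.n := one_le_two.trans hn
  refine ⟨hn₁, hk, hℓ, ?_, ?_, ?_⟩
  · exact (Nat.lt_pow_self hn).le.trans (Nat.pow_le_pow_right hn₁ (by omega))
  · calc I.numGuesses ≤ I.n ^ (I.k * I.m) * I.n ^ (2 * I.k) := Nat.mul_le_mul_left _ hcodes
      _ = I.n ^ (I.k * I.m + 2 * I.k) := (pow_add ..).symm
      _ ≤ I.n ^ (2 * I.k + I.k * I.m + 1) := Nat.pow_le_pow_right hn₁ (by omega)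
  · calc I.n * I.numCodes ≤ I.n * I.n ^ (2 * I.k) := Nat.mul_le_mul_left _ hcodes
      _ = I.n ^ (2 * I.k + 1) := (pow_succ' ..).symm
      _ ≤ I.n ^ (2 * I.k + I.k * I.m + 1) := Nat.pow_le_pow_right hn₁ (by omega)

theorem sampleSize_le_two_mul_sq {ε y : ℝ} (hε : 0 < ε) (hy : 1 ≤ y) (hεy : 1 / ε ≤ y) :
    (sampleSize ε : ℝ) ≤ 2 * y ^ 2 := by
  calc (sampleSize ε : ℝ) ≤ 1 / (ε * ε) + 1 := (Nat.ceil_lt_add_one (by positivity)).le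
    _ = (1 / ε) ^ 2 + 1 := by rw [← sq, one_div_pow]
    _ ≤ y ^ 2 + y ^ 2 := add_le_add (by gcongr) (one_le_pow₀ hy)
    _ = 2 * y ^ 2 := (two_mul _).symm

/-- The exponent of the running time, as a polynomial in `k / min ε 1`. -/
noncomputable def exponentPoly : Polynomial ℝ := 8 * Polynomial.X ^ 3 + 12 * Polynomial.X

theorem exponent_le_eval {k : ℕ} {ε : ℝ} (hk : 1 ≤ k) (hε : 0 < ε) :
    (((2 * k + k * sampleSize ε + 1) * 4 : ℕ) : ℝ) ≤ exponentPoly.eval (k / min ε 1) := by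
  have hδ : 0 < min ε 1 := lt_min hε one_pos
  have hk₁ : (1 : ℝ) ≤ k := mod_cast hk
  obtain ⟨y, hy⟩ : ∃ y, (k : ℝ) / min ε 1 = y := ⟨_, rfl⟩
  have hky : (k : ℝ) ≤ y := by
    rw [← hy, le_div_iff₀ hδ]
    exact mul_le_of_le_one_right (Nat.cast_nonneg k) (min_le_right ε 1)
  have hεy : 1 / ε ≤ y :=
    (div_le_div₀ (Nat.cast_nonneg k) hk₁ hδ (min_le_left ε 1)).trans_eq hy
  have hy₀ : 0 ≤ y := (Nat.cast_nonneg k).trans hky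
  have hm := sampleSize_le_two_mul_sq hε (hk₁.trans hky) hεy
  have hkm : (k : ℝ) * sampleSize ε ≤ y * (2 * y ^ 2) := by gcongr
  simp only [hy, exponentPoly, Polynomial.eval_add, Polynomial.eval_mul, Polynomial.eval_pow,
    Polynomial.eval_X, Polynomial.eval_ofNat]
  push_cast
  linarith

theorem steps_le {obj : Objective} {k n d t : ℕ} {ε : ℝ} (hk : 1 ≤ k) (hε : 0 < ε) (hn : 1 ≤ n)
    (ht : t ≤ (clusterProg obj).cost (n ^ (2 * k + k * sampleSize ε + 1)) d) :
    (t : ℝ) ≤ (clusterProg obj).coeff * (d + 1) * (n : ℝ) ^ exponentPoly.eval (k / min ε 1) := by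
  have hsteps := ht.trans (Program.cost_le d (Nat.one_le_pow _ _ hn) _)
  rw [growth_clusterProg, pow_one, ← pow_mul, ← mul_assoc] at hsteps
  calc (t : ℝ) ≤ (clusterProg obj).coeff * (d + 1) *
        (n : ℝ) ^ ((2 * k + k * sampleSize ε + 1) * 4) := mod_cast hsteps
    _ = (clusterProg obj).coeff * (d + 1) *
        (n : ℝ) ^ (((2 * k + k * sampleSize ε + 1) * 4 : ℕ) : ℝ) := by rw [Real.rpow_natCast]
    _ ≤ _ := by
      gcongr
      · exact mod_cast hn
      · exact exponent_le_eval hk hε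

end FairClustering

theorem mainTheorem6 (obj : FairClustering.Objective) :
    ∃ (prog : FairClustering.Program) (p : Polynomial ℝ) (K : ℝ),
      ∀ (k : ℕ) (ε : ℝ), 1 ≤ k → 0 < ε →
      ∀ (n d ℓ : ℕ) (A : Fin n → EuclideanSpace ℝ (Fin d)) (c : Fin n → Fin ℓ), 1 ≤ n →
      ∃ (s : FairClustering.Memory) (t : ℕ),
        FairClustering.Exec prog (FairClustering.inputMemory A c k ε) s t ∧
        (t : ℝ) ≤ K * (d + 1) * (n : ℝ) ^ p.eval ((k : ℝ) / min ε 1) ∧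
        ∀ C' : Fin n → EuclideanSpace ℝ (Fin d), FairClustering.IsFairClustering k c C' →
          FairClustering.IsFairClustering k c (FairClustering.outputMatrix n d s) ∧
          obj.cost A (FairClustering.outputMatrix n d s) ≤ (1 + ε) * obj.cost A C' := by
  open FairClustering in
  refine ⟨clusterProg obj, exponentPoly, (clusterProg obj).coeff, fun k ε hk hε n d ℓ A c hn => ?_⟩
  obtain ⟨s, t, hexec, ht, hs⟩ := runs_clusterProg (A := A) (c := c) (obj := obj) hε hk hn
    fun hn₂ hℓ => Instance.loopBounds hn₂ hk hℓ
  exact ⟨s, t, hexec, steps_le hk hε hn ht, hs⟩
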